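/- **Theorem (Completion time of the BB84 protocol, version V1).** *Model.* Write $M_Z(t)=\mathsf E(e^{tZ})$, and let $\mathrm{SE}(\lambda,a)$ be the law of $a+E$ with $E$ exponential of rate $\lambda$. Fix rates $\lambda_{\rm gen},\lambda_{\rm com},\lambda_{\rm swap},\lambda_{AB}>0$, shifts $a_{\rm gen},a_{\rm com},a_{\rm swap},a_{AB}\ge 0$, probabilities $p_{\rm gen},p_{\rm swap}\in(0,1]$, a Werner parameter $w_0\in[-\frac13,1]$, constants $t_c,t_{de},t_{da}>0$, fractions $\alpha\in(0,1]$, $\beta\in[0,1]$, and an integer $n\ge 1$. All random choices below are independent unless a dependence is described. - *Links.* Each of Alice and Bob repeats link trials with the repeater; a trial has a generation duration $\sim\mathrm{SE}(\lambda_{\rm gen},a_{\rm gen})$, a communication duration $\sim\mathrm{SE}(\lambda_{\rm com},a_{\rm com})$, and succeeds with probability $p_{\rm gen}$. For user $U\in\{A,B\}$, $T_{HU}$ is the total duration of all trials up to the first success, without the communication phase of the successful trial, whose duration is $T_{CU}$; $V_U=T_{HU}+T_{CU}$. - *Swap trials.* At time $\max\{V_A,V_B\}$ a Bell state measurement is made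 at the repeater, which succeeds with probability $p_{\rm swap}$; in either case a communication phase of duration $T_C'\sim\mathrm{SE}(\lambda_{\rm swap},a_{\rm swap})$ follows. Failed swap trials are restarted from scratch; $T_\gamma$ is the total duration of the failed ones (each of duration $\max\{V_A,V_B\}+T_C'$). - *Entanglement.* The Werner state of parameter $w$ is $\frac{1+3w}{4}|\Phi^+\rangle\langle\Phi^+|+\frac{1-w}{4}(|\Phi^-\rangle\langle\Phi^-|+|\Psi^+\rangle\langle\Psi^+|+|\Psi^-\rangle\langle\Psi^-|)$. Each link is a Werner state with parameter $w_0$ when generated (at time $T_{HU}$); parameters decay by the factor $e^{-s/t_c}$ during a time $s$. A successful swap yields a Werner state whose parameter is the product of the two current ones, which decays further during $T_C'$. - *Teleportation.* Alice encodes a uniform bit in a uniformly chosen basis ($|0\rangle,|1\rangle$ or $|+\rangle,|-\rangle$) and teleports it by the standard protocol through the Werner state. While her measurement results travel, for a time $T_C''\sim\mathrm{SE}(\lambda_{AB},a_{AB})$, Bob's qubit undergoes the noise $\mathcal N_t(\rho)=(1-p)\sigma+p\,Z\sigma Z$ with $\sigma=M_0\rho M_0^\dagger+M_1\rho M_1^\dagger$,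 $M_0=\mathrm{diag}(1,\sqrt{1-\gamma})$, $M_1=\sqrt{\gamma}\,|0\rangle\langle1|$, $p=(1-e^{-t/t_{de}})/2$, $\gamma=1-e^{-t/t_{da}}$, taken at $t=T_C''$; then Bob applies the Pauli correction and measures. $X=T_\gamma+\max\{V_A,V_B\}+T_C'+T_C''$ (last three terms from the successful swap trial and the teleportation) is the duration of the teleportation of a qubit, and $Y\in\{0,1\}$ indicates that Bob's result, if he measures in Alice's basis, equals Alice's bit. - *Protocol.* In an attempt $n$ qubits are teleported one after the other, Bob measuring each in a uniformly random basis; then a reconciliation phase of duration $K_C\sim\mathrm{SE}(\lambda_{AB},a_{AB})$ takes place. If $B$ is the number of qubits with matching bases, $B_1=\lceil\alpha B\rceil$ of these are sampled uniformly without replacement; the attempt succeeds iff $B_1\ge1$ and Bob's result agrees with Alice's bit for at least $\beta B_1$ of the sampled qubits. Independent attempts are repeated until the first success; $W_n$ is the total duration. *Definitions.* Let $m_1(t)=\mathsf E(e^{tX}Y)$, $m_0(t)=\mathsf E(e^{tX}(1-Y))$, and for $0<s\le\infty$ $$I(t,s)=\mathsf E\Big(e^{t\max\{V_A,V_B\}}e^{-\frac{|V_A-V_B|+T_{CA}+T_{CB}}{s}}\Big).$$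 For $l\ge 1$ let $M^{(1)}(t;l,0)=(m_0+m_1)^l$ and $M^{(1)}(t;l,l)=m_1^l$; for $l\ge2$ let $M^{(1)}(t;l,l-1)=m_1^l+l\,m_0m_1^{l-1}$, and for $1\le j\le l-2$ $$M^{(1)}(t;l,j)=\sum_{k=0}^{1}\binom{l-k}{j}m_0^{l-k-j}m_1^{j+k}+m_1\sum_{k=j}^{l-2}(m_0+m_1)^{l-1-k}\binom kj m_0^{k-j}m_1^j$$ (with $m_0,m_1$ evaluated at $t$). Let $$D_n(t)=\sum_{k=1}^{\lceil\alpha n\rceil}M^{(1)}(t;k,\lceil\beta k\rceil)\,M_X(t)^{n-k}\,\frac1{2^n}\sum_{\frac{k-1}{\alpha}<j\le\frac k\alpha}\binom nj .$$ *Claim.* Almost surely some attempt succeeds, and for every $t\in\mathbb R$: 1. $M_{W_n}(t)<\infty$ if and only if $M_{K_C}(t)<\infty$, $M_X(t)<\infty$ and $M_{K_C}(t)\,(M_X(t)^n-D_n(t))<1$. In that case $$M_{W_n}(t)=\frac{M_{K_C}(t)D_n(t)}{1-M_{K_C}(t)\,(M_X(t)^n-D_n(t))}.$$ 2. $M_X(t)<\infty$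 if and only if $I(t,\infty)$, $M_{T_C'}(t)$, $M_{T_C''}(t)$ are finite and $(1-p_{\rm swap})M_{T_C'}(t)I(t,\infty)<1$. In that case $$M_{T_\gamma}(t)=\frac{p_{\rm swap}}{1-(1-p_{\rm swap})M_{T_C'}(t)I(t,\infty)},\qquad M_X(t)=M_{T_\gamma}(t)I(t,\infty)M_{T_C'}(t)M_{T_C''}(t),$$ $$m_1(t)=\tfrac14M_{T_\gamma}(t)\Big(2I(t,\infty)M_{T_C'}(t)M_{T_C''}(t)+w_0^2I(t,t_c)M_{T_C'}(t-\tfrac1{t_c})\big(M_{T_C''}(t-\tfrac1{t_{da}})+M_{T_C''}(t-\tfrac1{t_{de}}-\tfrac1{2t_{da}})\big)\Big),$$ $m_0(t)=M_X(t)-m_1(t)$, $m_1(t)=\mathsf E(e^{tX}\mid Y=1)\,\mathsf P(Y=1)$ and $m_0(t)=\mathsf E(e^{tX}\mid Y=0)\,\mathsf P(Y=0)$ (a product being $0$ if its probability factor is $0$). -/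

import Mathlib

set_option synthInstance.maxSize 4096

open MeasureTheory ProbabilityTheory

namespace BB84

noncomputable section

/-! ## Qubits, Bell states, Werner states, memory noise, teleportation -/

/-- Single-qubit operators. -/
abbrev Op := Matrix (Fin 2) (Fin 2) ℂ

/-- The rank-one operator `|v⟩⟨v|`. -/
def proj {ι : Type} (v : ι → ℂ) : Matrix ι ι ℂ := Matrix.vecMulVec v (star v)

/-- The two encoding bases: `false` is the computational basis `|0⟩, |1⟩`,
`true` is the diagonal basis `|+⟩, |-⟩`. -/
def basisVec (basis : Bool) (bit : Fin 2) : Fin 2 → ℂ :=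
  if basis then fun i => (-1) ^ (bit.val * i.val) / (Real.sqrt 2 : ℂ) else Pi.single bit 1

/-- The Bell states: `(z, x) = (0,0), (1,0), (0,1), (1,1)` give `Φ⁺, Φ⁻, Ψ⁺, Ψ⁻`. -/
def bell (z x : Fin 2) : Fin 2 × Fin 2 → ℂ := fun p =>
  if p.2 = p.1 + x then (-1) ^ (z.val * p.1.val) / (Real.sqrt 2 : ℂ) else 0

/-- The Werner state with Werner parameter `w`. -/
def werner (w : ℝ) : Matrix (Fin 2 × Fin 2) (Fin 2 × Fin 2) ℂ :=
  (((1 + 3 * w) / 4 : ℝ) : ℂ) • proj (bell 0 0) +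
    (((1 - w) / 4 : ℝ) : ℂ) • (proj (bell 1 0) + proj (bell 0 1) + proj (bell 1 1))

def pauliX : Op := !![0, 1; 1, 0]

def pauliZ : Op := !![1, 0; 0, -1]

def hadamard : Op := (1 / (Real.sqrt 2 : ℂ)) • !![1, 1; 1, -1]

/-- Dephasing plus amplitude damping during a time `t`, with dephasing constant `tde` and
amplitude damping constant `tda`. -/
def noise (tde tda t : ℝ) (ρ : Op) : Op :=
  let γ : ℝ := 1 - Real.exp (-t / tda)
  let p : ℝ := (1 - Real.exp (-t / tde)) / 2
  let M₀ : Op := !![1, 0; 0, (Real.sqrt (1 - γ) : ℂ)]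
  let M₁ : Op := !![0, (Real.sqrt γ : ℂ); 0, 0]
  let σ : Op := M₀ * ρ * M₀.conjTranspose + M₁ * ρ * M₁.conjTranspose
  ((1 - p : ℝ) : ℂ) • σ + (p : ℂ) • (pauliZ * σ * pauliZ)

/-- CNOT on three qubits, control the first one (data), target the second one (Alice's half of
the resource); the third one is Bob's half. -/
def cnot : Matrix (Fin 2 × Fin 2 × Fin 2) (Fin 2 × Fin 2 × Fin 2) ℂ :=
  Matrix.of fun a b => if a.1 = b.1 ∧ a.2.1 = b.1 + b.2.1 ∧ a.2.2 = b.2.2 then 1 else 0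

/-- The joint state of (data, Alice's half, Bob's half) right before Alice's measurement, for
data state `φ` and a Werner resource of parameter `w`. -/
def beforeMeasurement (φ : Fin 2 → ℂ) (w : ℝ) :
    Matrix (Fin 2 × Fin 2 × Fin 2) (Fin 2 × Fin 2 × Fin 2) ℂ :=
  let U := Matrix.kroneckerMap (· * ·) hadamard
    (1 : Matrix (Fin 2 × Fin 2) (Fin 2 × Fin 2) ℂ) * cnot
  U * Matrix.kroneckerMap (· * ·) (proj φ) (werner w) * U.conjTranspose

/-- Unnormalised state of Bob's qubit when Alice measures `l` on the data qubit and `k` on her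
half of the resource; its trace is the probability of that outcome. -/
def bobConditional (φ : Fin 2 → ℂ) (w : ℝ) (l k : Fin 2) : Op :=
  Matrix.of fun i j => beforeMeasurement φ w (l, k, i) (l, k, j)

/-- The final state of Bob's qubit: after Alice's measurement it waits in a noisy memory for the
time `t` that the measurement results need to reach Bob, who then applies `Z ^ l * X ^ k`. -/
def teleported (tde tda : ℝ) (φ : Fin 2 → ℂ) (w t : ℝ) : Op :=
  ∑ l : Fin 2, ∑ k : Fin 2,
    (pauliZ ^ l.val * pauliX ^ k.val) * noise tde tda t (bobConditional φ w l k) *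
      (pauliZ ^ l.val * pauliX ^ k.val).conjTranspose

/-- Probability `⟨v|ρ|v⟩` of the outcome `bit` when `ρ` is measured in the given basis. -/
def bornProb (ρ : Op) (basis : Bool) (bit : Fin 2) : ℝ :=
  (star (basisVec basis bit) ⬝ᵥ Matrix.mulVec ρ (basisVec basis bit)).re

/-! ## Parameters -/

/-- The numerical parameters of the model. -/
structure Params where
  rateGen : ℝ
  shiftGen : ℝ
  rateCom : ℝ
  shiftCom : ℝ
  rateSwap : ℝ
  shiftSwap : ℝ
  rateAB : ℝ
  shiftAB : ℝ
  pGen : ℝ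
  pSwap : ℝ
  w0 : ℝ
  tc : ℝ
  tde : ℝ
  tda : ℝ
  α : ℝ
  β : ℝ
  rateGen_pos : 0 < rateGen
  shiftGen_nonneg : 0 ≤ shiftGen
  rateCom_pos : 0 < rateCom
  shiftCom_nonneg : 0 ≤ shiftCom
  rateSwap_pos : 0 < rateSwap
  shiftSwap_nonneg : 0 ≤ shiftSwap
  rateAB_pos : 0 < rateAB
  shiftAB_nonneg : 0 ≤ shiftAB
  pGen_pos : 0 < pGen
  pGen_le_one : pGen ≤ 1
  pSwap_pos : 0 < pSwap
  pSwap_le_one : pSwap ≤ 1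
  /-- `-1/3 ≤ w ≤ 1` is the range in which the Werner operator is a state. -/
  neg_third_le_w0 : -1 / 3 ≤ w0
  w0_le_one : w0 ≤ 1
  tc_pos : 0 < tc
  tde_pos : 0 < tde
  tda_pos : 0 < tda
  α_pos : 0 < α
  α_le_one : α ≤ 1
  β_nonneg : 0 ≤ β
  β_le_one : β ≤ 1

/-- The shifted exponential law `SE(rate, shift)`: an `Exp(rate)` variable plus `shift`. -/
def seLaw (rate shift : ℝ) : Measure ℝ := (expMeasure rate).map (fun x => x + shift)

lemma isProbabilityMeasure_seLaw {rate : ℝ} (h : 0 < rate) (shift : ℝ) :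
    IsProbabilityMeasure (seLaw rate shift) :=
  haveI := isProbabilityMeasure_expMeasure h
  Measure.isProbabilityMeasure_map (by fun_prop)

/-- Index (from `0`) of the first trial that succeeds. It is `0` if no trial succeeds, which has
probability zero wherever this is used. -/
def firstSuccess (ok : ℕ → Prop) : ℕ := sInf {k | ok k}

variable (P : Params) (n : ℕ)

/-- Law of a `LINK-GEN` duration. -/
def genLaw : Measure ℝ := seLaw P.rateGen P.shiftGen

/-- Law of an `L-COMM` duration. -/
def comLaw : Measure ℝ := seLaw P.rateCom P.shiftCom

/-- Law of an `S-COMM` duration `T_C'`. -/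
def swapComLaw : Measure ℝ := seLaw P.rateSwap P.shiftSwap

/-- Law of a `T-COMM` duration `T_C''` and of a `K-COMM` duration `K_C`. -/
def abLaw : Measure ℝ := seLaw P.rateAB P.shiftAB

instance : IsProbabilityMeasure (genLaw P) := isProbabilityMeasure_seLaw P.rateGen_pos _
instance : IsProbabilityMeasure (comLaw P) := isProbabilityMeasure_seLaw P.rateCom_pos _
instance : IsProbabilityMeasure (swapComLaw P) := isProbabilityMeasure_seLaw P.rateSwap_pos _
instance : IsProbabilityMeasure (abLaw P) := isProbabilityMeasure_seLaw P.rateAB_pos _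

/-! ## Elementary links -/

/-- One link generation trial of one user:
(`LINK-GEN` duration, `L-COMM` duration, success flag). -/
abbrev LinkTrial := ℝ × ℝ × Bool

/-- The sequence of link generation trials of one user. -/
abbrev LinkRun := ℕ → LinkTrial

def linkTrialLaw : Measure LinkTrial :=
  (genLaw P).prod ((comLaw P).prod
    (bernoulliMeasure true false ⟨P.pGen, P.pGen_pos.le, P.pGen_le_one⟩))

instance : IsProbabilityMeasure (linkTrialLaw P) := by unfold linkTrialLaw; infer_instance

/-- Independent trials. -/
def linkRunLaw : Measure LinkRun := Measure.infinitePi fun _ : ℕ => linkTrialLaw P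

instance : IsProbabilityMeasure (linkRunLaw P) := by unfold linkRunLaw; infer_instance

/-- Index of the successful link generation trial. -/
def linkIdx (r : LinkRun) : ℕ := firstSuccess fun k => (r k).2.2 = true

/-- `T_H`: the time at which the link is generated; all `LINK-GEN` phases up to the successful
one, and the `L-COMM` phases of the failed trials. -/
def tH (r : LinkRun) : ℝ :=
  ∑ k ∈ Finset.range (linkIdx r + 1), (r k).1 + ∑ k ∈ Finset.range (linkIdx r), (r k).2.1

/-- `T_C`: duration of the `L-COMM` phase of the successful trial. -/
def tC (r : LinkRun) : ℝ := (r (linkIdx r)).2.1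

/-- `V = T_H + T_C`. -/
def v (r : LinkRun) : ℝ := tH r + tC r

/-! ## Swap trials -/

/-- One swap trial: (Alice's link trials, Bob's link trials, `S-COMM` duration, whether the Bell
state measurement at the repeater succeeds). -/
abbrev SwapTrial := LinkRun × LinkRun × ℝ × Bool

def swapTrialLaw : Measure SwapTrial :=
  (linkRunLaw P).prod ((linkRunLaw P).prod ((swapComLaw P).prod
    (bernoulliMeasure true false ⟨P.pSwap, P.pSwap_pos.le, P.pSwap_le_one⟩)))

instance : IsProbabilityMeasure (swapTrialLaw P) := by unfold swapTrialLaw; infer_instance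

/-- `max {V_A, V_B}`: the time at which the Bell state measurement takes place. -/
def vMax (s : SwapTrial) : ℝ := max (v s.1) (v s.2.1)

/-- `T_C'`. -/
def tC' (s : SwapTrial) : ℝ := s.2.2.1

/-- Werner parameter of the end-to-end link at the start of teleportation. Each elementary link
is generated at its time `T_H` and decays until the measurement; the end-to-end link starts with
the product of the two parameters and decays during the `S-COMM` phase. -/
def endWerner (s : SwapTrial) : ℝ :=
  (P.w0 * Real.exp (-(vMax s - tH s.1) / P.tc)) *
    (P.w0 * Real.exp (-(vMax s - tH s.2.1) / P.tc)) * Real.exp (-tC' s / P.tc)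

/-- `I(t,s) = E (exp (t max{V_A,V_B}) exp (-(|V_A-V_B| + T_CA + T_CB)/s))`, for `s` positive,
`s = ∞` allowed (then `1/s = 0`). -/
def I (t : ℝ) (s : EReal) : ℝ :=
  ∫ x, Real.exp (t * vMax x) *
    Real.exp (-(|v x.1 - v x.2.1| + tC x.1 + tC x.2.1) * (s⁻¹).toReal) ∂swapTrialLaw P

/-! ## Teleportation of a single qubit -/

/-- One teleported qubit: (swap trials, `T-COMM` duration, Alice's bit, Alice's basis,
Bob's basis, seed of the outcome of Bob's measurement). -/
abbrev Qubit := (ℕ → SwapTrial) × ℝ × Fin 2 × Bool × Bool × unitInterval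

/-- Swap trials are independent, bits and bases uniform, and everything is independent. -/
def qubitLaw : Measure Qubit :=
  (Measure.infinitePi fun _ : ℕ => swapTrialLaw P).prod ((abLaw P).prod
    ((uniformOn Set.univ).prod ((uniformOn Set.univ).prod ((uniformOn Set.univ).prod volume))))

instance : IsProbabilityMeasure (qubitLaw P) := by unfold qubitLaw; infer_instance

/-- Index of the successful swap trial. -/
def swapIdx (q : Qubit) : ℕ := firstSuccess fun j => (q.1 j).2.2.2 = true

/-- `T_γ`: total duration of the failed swap trials. -/
def tGamma (q : Qubit) : ℝ := ∑ j ∈ Finset.range (swapIdx q), (vMax (q.1 j) + tC' (q.1 j))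

/-- `T_C''`. -/
def tC'' (q : Qubit) : ℝ := q.2.1

/-- `X`: duration of the teleportation of a qubit. -/
def X (q : Qubit) : ℝ := tGamma q + vMax (q.1 (swapIdx q)) + tC' (q.1 (swapIdx q)) + tC'' q

def aliceBit (q : Qubit) : Fin 2 := q.2.2.1

def aliceBasis (q : Qubit) : Bool := q.2.2.2.1

def bobBasis (q : Qubit) : Bool := q.2.2.2.2.1

/-- Bob's result if he measures in the given basis. The seed is uniform on `[0,1]` and independent
of everything else, so given all the rest the result is `0` with its Born probability. -/
def result (q : Qubit) (basis : Bool) : Fin 2 :=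
  if (q.2.2.2.2.2 : ℝ) < bornProb
      (teleported P.tde P.tda (basisVec (aliceBasis q) (aliceBit q))
        (endWerner P (q.1 (swapIdx q))) (tC'' q)) basis 0
  then 0 else 1

/-- `Y`: indicator that Bob's result, when he measures in the basis in which Alice encoded the
qubit, coincides with Alice's bit. -/
def Y (q : Qubit) : ℝ := if result P q (aliceBasis q) = aliceBit q then 1 else 0

/-! ## Attempts and completion time -/

/-- One attempt: (the qubits, for each set `S` of qubits the random sample that is checked if `S`
is the set of qubits with matching bases, the `K-COMM` duration). -/
abbrev Attempt := (Fin n → Qubit) × (Finset (Fin n) → Finset (Fin n)) × ℝ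

/-- The sample from `S` is uniform among the subsets of `S` of size `⌈α |S|⌉`. -/
def sampleLaw (S : Finset (Fin n)) : Measure (Finset (Fin n)) :=
  uniformOn (Finset.powersetCard ⌈P.α * (S.card : ℝ)⌉₊ S : Set (Finset (Fin n)))

instance (S : Finset (Fin n)) : IsProbabilityMeasure (sampleLaw P n S) := by
  refine isProbabilityMeasure_uniformOn (Finset.finite_toSet _) ?_
  rw [Finset.coe_nonempty, Finset.powersetCard_nonempty, Nat.ceil_le]
  exact mul_le_of_le_one_left (Nat.cast_nonneg _) P.α_le_one

def attemptLaw : Measure (Attempt n) :=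
  (Measure.pi fun _ : Fin n => qubitLaw P).prod
    ((Measure.pi fun S : Finset (Fin n) => sampleLaw P n S).prod (abLaw P))

instance : IsProbabilityMeasure (attemptLaw P n) := by unfold attemptLaw; infer_instance

variable {n} in
/-- The qubits for which the bases of Alice and Bob agree. -/
def matching (a : Attempt n) : Finset (Fin n) :=
  Finset.univ.filter fun i => bobBasis (a.1 i) = aliceBasis (a.1 i)

variable {n} in
/-- The qubits that are checked. -/
def sample (a : Attempt n) : Finset (Fin n) := a.2.1 (matching a)

variable {n} in
/-- An attempt succeeds if at least one qubit is checked and Bob's result (in his own basis) is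
Alice's bit for at least a fraction `β` of the checked qubits. -/
def success (a : Attempt n) : Prop :=
  1 ≤ (sample a).card ∧
    P.β * ((sample a).card : ℝ) ≤
      (((sample a).filter fun i => result P (a.1 i) (bobBasis (a.1 i)) = aliceBit (a.1 i)).card : ℝ)

variable {n} in
/-- Duration of an attempt: `n` teleportations in sequence, then reconciliation. -/
def duration (a : Attempt n) : ℝ := ∑ i, X (a.1 i) + a.2.2

/-- Independent attempts. -/
def protocolLaw : Measure (ℕ → Attempt n) := Measure.infinitePi fun _ : ℕ => attemptLaw P n

instance : IsProbabilityMeasure (protocolLaw P n) := by unfold protocolLaw; infer_instance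

variable {n} in
/-- `W_n`: total duration of the attempts up to and including the first successful one. -/
def W (ω : ℕ → Attempt n) : ℝ :=
  ∑ r ∈ Finset.range (firstSuccess (fun r => success P (ω r)) + 1), duration (ω r)

/-! ## The quantities in the closed form -/

/-- `m_1(t) = E (e^{tX} Y)`. -/
def m1 (t : ℝ) : ℝ := ∫ q, Real.exp (t * X q) * Y P q ∂qubitLaw P

/-- `m_0(t) = E (e^{tX} (1 - Y))`. -/
def m0 (t : ℝ) : ℝ := ∫ q, Real.exp (t * X q) * (1 - Y P q) ∂qubitLaw P

/-- `M_X(t)`. -/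
def MX (t : ℝ) : ℝ := mgf X (qubitLaw P) t

/-- `M_{K_C}(t)`. -/
def MK (t : ℝ) : ℝ := mgf id (abLaw P) t

/-- The coefficients `M⁽¹⁾(t; l, j)`, `j ≤ l`, `1 ≤ l`. -/
def M1 (t : ℝ) (l j : ℕ) : ℝ :=
  if j = 0 then (m0 P t + m1 P t) ^ l
  else if j = l then m1 P t ^ l
  else if j + 1 = l then m1 P t ^ l + (l.choose 1 : ℝ) * m0 P t * m1 P t ^ (l - 1)
  else
    ∑ k ∈ Finset.range 2, ((l - k).choose j : ℝ) * m0 P t ^ (l - k - j) * m1 P t ^ (j + k) +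
      m1 P t * ∑ k ∈ Finset.Icc j (l - 2),
        (m0 P t + m1 P t) ^ (l - 1 - k) * (k.choose j : ℝ) * m0 P t ^ (k - j) * m1 P t ^ j

/-- `D_n(t)`. The inner sum runs over the integers `j` with `(k-1)/α < j ≤ k/α`. -/
def D (t : ℝ) : ℝ :=
  ∑ k ∈ Finset.Icc 1 ⌈P.α * (n : ℝ)⌉₊,
    M1 P t k ⌈P.β * (k : ℝ)⌉₊ * MX P t ^ (n - k) *
      (1 / 2 ^ n *
        ∑ j ∈ Finset.Ioc ⌊((k : ℝ) - 1) / P.α⌋₊ ⌊(k : ℝ) / P.α⌋₊, (n.choose j : ℝ))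

end

end BB84

open scoped ENNReal

namespace BB84

/-! The probabilistic core is a single computation. When independent trials are repeated up to the
first success, each failure weighted by `g` and the success by `h`, Tonelli and independence turn
the expected product into a geometric series with sum `(1 - E[g; failure])⁻¹ * E[h; success]`
(`lintegral_firstSuccess`). It serves once for the swap trials (`lintegral_tGamma_mul`) and once for
the attempts (`lmgf_W`). In `ℝ≥0∞` it needs no convergence hypothesis: the first factor is infinite
exactly when the failure weight is at least 1. Since none of the factors of `lmgf_X` and `lmgf_W`
vanishes, each product is finite iff every factor is, which gives both directions of the finiteness
criteria; the real formulas follow by `toReal`.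

For one qubit, summing over Alice's outcomes with their Pauli corrections removes the bias of
amplitude damping towards `|0⟩`, so Bob agrees with Alice with probability `(1 + w * e) / 2` for
either bit, where `e` decays exponentially in `T_C''` (`bornProb_teleported`). The parameter `w` is
itself `w₀²` times exponentials of the storage time and of `T_C'` (`endWerner_eq`). Multiplied by
`e^{tX}`, these decays only shift the arguments of the transforms, whence `lm1_eq`.

For one attempt, Bob's basis is uniform and affects neither `X` nor `Y`, so prescribing whether the
bases match costs a factor `1/2` per qubit. For a fixed sample and a fixed set of correct results
the weight factors over the qubits into `m₁`, `m₀` and `M_X`, and depends only on cardinalities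
(`lintegral_passes`, `setLIntegral_success`). What remains is a binomial tail, and `M⁽¹⁾` is that
tail, split according to the position of a success (`M1_eq_binomTail`).

Finiteness of `M_X` is necessary because agreement has conditional probability at least `1/2`: `m₁ ≥
M_X / 2`, so the success part of an attempt already diverges with `M_X`. -/

/-! ### Teleportation through a Werner state -/

lemma sqrt_two_complex_mul_self : (Real.sqrt 2 : ℂ) * (Real.sqrt 2 : ℂ) = 2 := by
  rw [← Complex.ofReal_mul, Real.mul_self_sqrt (by norm_num)]; norm_num

lemma inv_sqrt_two_complex_mul_self : (Real.sqrt 2 : ℂ)⁻¹ * (Real.sqrt 2 : ℂ)⁻¹ = 1 / 2 := by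
  rw [← mul_inv, sqrt_two_complex_mul_self]; norm_num

/-- The four Bell projectors sum to the identity, so the state is `(1 - w) / 4` times the identity
plus `w` times the projector on `Φ⁺`, whose nonzero entries are `1 / 2`. -/
lemma werner_apply (w : ℝ) (a i a' j : Fin 2) :
    werner w (a, i) (a', j) =
      (1 - w) / 4 * (if a = a' ∧ i = j then 1 else 0) +
        w / 2 * (if i = a ∧ j = a' then 1 else 0) := by
  have h := inv_sqrt_two_complex_mul_self
  fin_cases a <;> fin_cases i <;> fin_cases a' <;> fin_cases j <;>
    simp [werner, proj, bell, Matrix.vecMulVec_apply, div_eq_mul_inv, h] <;> ring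

lemma hadamard_apply (l d : Fin 2) :
    hadamard l d = (-1) ^ (l.val * d.val) / (Real.sqrt 2 : ℂ) := by
  fin_cases l <;> fin_cases d <;> simp [hadamard, div_eq_mul_inv]

/-- CNOT permutes the computational basis, and addition in `Fin 2` is XOR: reading `k` on Alice's
half forces `k` to be the sum of the data bit and the resource bit. -/
lemma hadamard_cnot_apply (l k i : Fin 2) (b : Fin 2 × Fin 2 × Fin 2) :
    (Matrix.kroneckerMap (· * ·) hadamard (1 : Matrix (Fin 2 × Fin 2) (Fin 2 × Fin 2) ℂ) * cnot)
      (l, k, i) b = if k = b.1 + b.2.1 ∧ i = b.2.2 then hadamard l b.1 else 0 := by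
  obtain ⟨d, a, c⟩ := b
  simp only [Matrix.mul_apply, Fintype.sum_prod_type, Fin.sum_univ_two, Matrix.kroneckerMap_apply,
    cnot, Matrix.of_apply, Matrix.one_apply]
  fin_cases d <;> fin_cases a <;> fin_cases c <;> fin_cases k <;> fin_cases i <;> simp

/-- Once `k` is read, the data bit `d` determines Alice's half as `k + d` (signs are immaterial in
`Fin 2`), so only the data indices are summed. -/
lemma bobConditional_apply (φ : Fin 2 → ℂ) (w : ℝ) (l k i j : Fin 2) :
    bobConditional φ w l k i j = ∑ d, ∑ d', hadamard l d * star (hadamard l d') *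
      (φ d * star (φ d')) * werner w (k + d, i) (k + d', j) := by
  simp only [bobConditional, Matrix.of_apply, beforeMeasurement]
  rw [Matrix.mul_apply]
  simp only [Matrix.mul_apply (N := Matrix.kroneckerMap _ _ _), Matrix.conjTranspose_apply,
    hadamard_cnot_apply, Fintype.sum_prod_type, Fin.sum_univ_two, Matrix.kroneckerMap_apply, proj,
    Matrix.vecMulVec_apply, Pi.star_apply]
  fin_cases k <;> fin_cases i <;> fin_cases j <;> simp <;> ring

/-- Coherences are multiplied by `√(1 - γ) = e^{-t/(2 tda)}` from damping and by `1 - 2p =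
e^{-t/tde}` from dephasing; dephasing leaves the diagonal alone. The sign condition gives `γ ≥ 0`,
without which `√γ * √γ = γ` fails. -/
lemma noise_eq (tde tda t : ℝ) (ht : 0 ≤ t / tda) (ρ : Op) :
    noise tde tda t ρ =
      !![ρ 0 0 + (1 - Real.exp (-t / tda) : ℝ) * ρ 1 1,
          (Real.exp (-t / tde - t / (2 * tda)) : ℝ) * ρ 0 1;
        (Real.exp (-t / tde - t / (2 * tda)) : ℝ) * ρ 1 0, (Real.exp (-t / tda) : ℝ) * ρ 1 1] := by
  obtain ⟨x, y, z, u, rfl⟩ : ∃ x y z u, ρ = !![x, y; z, u] := ⟨_, _, _, _, ρ.eta_fin_two⟩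
  have hγ : 0 ≤ 1 - Real.exp (-t / tda) := by
    rw [sub_nonneg, Real.exp_le_one_iff, neg_div]; linarith
  have hs : Real.sqrt (1 - (1 - Real.exp (-t / tda))) = Real.exp (-(t / (2 * tda))) := by
    rw [sub_sub_cancel, Real.sqrt_eq_iff_mul_self_eq (Real.exp_pos _).le (Real.exp_pos _).le,
      ← Real.exp_add]
    congr 1
    rw [← div_div, div_right_comm, neg_div]; ring
  have h1 : ((Real.sqrt (1 - Real.exp (-t / tda)) : ℝ) : ℂ) *
      ((Real.sqrt (1 - Real.exp (-t / tda)) : ℝ) : ℂ) = ((1 - Real.exp (-t / tda) : ℝ) : ℂ) := by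
    rw [← Complex.ofReal_mul, Real.mul_self_sqrt hγ]
  have h2 : ((Real.exp (-(t / (2 * tda))) : ℝ) : ℂ) * ((Real.exp (-(t / (2 * tda))) : ℝ) : ℂ) =
      ((Real.exp (-t / tda) : ℝ) : ℂ) := by
    rw [← Complex.ofReal_mul, ← Real.exp_add]
    congr 2
    rw [← div_div, div_right_comm, neg_div]; ring
  have h3 : Real.exp (-t / tde - t / (2 * tda)) =
      (1 - 2 * ((1 - Real.exp (-t / tde)) / 2)) * Real.exp (-(t / (2 * tda))) := by
    rw [sub_eq_add_neg (-t / tde), Real.exp_add]; ring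
  rw [h3]
  simp only [noise, hs]
  generalize Real.sqrt (1 - Real.exp (-t / tda)) = r at *
  generalize Real.exp (-(t / (2 * tda))) = s at *
  generalize (1 - Real.exp (-t / tde)) / 2 = p at *
  generalize Real.exp (-t / tda) = g at *
  ext i j
  fin_cases i <;> fin_cases j <;>
    simp [Fin.sum_univ_two, pauliZ, Matrix.conjTranspose_apply, Matrix.vecMul,
      dotProduct, Matrix.vecHead, Matrix.vecTail]
  · push_cast at h1; linear_combination u * h1
  · ring
  · ring
  · linear_combination u * h2

lemma pauli_conj_apply (ρ : Op) (l k i j : Fin 2) :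
    ((pauliZ ^ l.val * pauliX ^ k.val) * ρ * (pauliZ ^ l.val * pauliX ^ k.val).conjTranspose) i j =
      (-1) ^ (l.val * (i.val + j.val)) * ρ (i + k) (j + k) := by
  obtain ⟨x, y, z, u, rfl⟩ : ∃ x y z u, ρ = !![x, y; z, u] := ⟨_, _, _, _, ρ.eta_fin_two⟩
  fin_cases l <;> fin_cases k <;> fin_cases i <;> fin_cases j <;>
    simp [Matrix.mul_apply, Fin.sum_univ_two, pauliZ, pauliX, Matrix.conjTranspose_apply,
      Matrix.one_apply, Matrix.vecHead, Matrix.vecTail]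

/-- The probability that Bob reads `0` in Alice's basis. -/
lemma bornProb_teleported (tde tda t w : ℝ) (ht : 0 ≤ t / tda) (a : Bool) (b : Fin 2) :
    bornProb (teleported tde tda (basisVec a b) w t) a 0 =
      1 / 2 * (1 + (-1) ^ b.val *
        (w * if a then Real.exp (-t / tde - t / (2 * tda)) else Real.exp (-t / tda))) := by
  have h := inv_sqrt_two_complex_mul_self
  rw [bornProb]
  have : (star (basisVec a 0) ⬝ᵥ
      Matrix.mulVec (teleported tde tda (basisVec a b) w t) (basisVec a 0)) =
      ((1 / 2 * (1 + (-1) ^ b.val *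
        (w * if a then Real.exp (-t / tde - t / (2 * tda)) else Real.exp (-t / tda))) : ℝ) : ℂ) :=
    by
    simp only [dotProduct, Matrix.mulVec, teleported, Fin.sum_univ_two, Matrix.add_apply,
      pauli_conj_apply, noise_eq tde tda t ht, bobConditional_apply, werner_apply, hadamard_apply]
    -- With the exponentials turned into atoms, each choice of basis and bit leaves a polynomial
    -- identity, in which `√2` occurs only through even powers of its inverse.
    generalize Real.exp (-t / tde - t / (2 * tda)) = s at *
    generalize Real.exp (-t / tda) = g at *
    have h2 : ((Real.sqrt 2 : ℂ)⁻¹) ^ 2 = 1 / 2 := by rw [pow_two, h]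
    cases a <;> fin_cases b <;> simp [basisVec, div_eq_mul_inv] <;> simp only [h] <;> ring_nf <;>
      simp only [h2] <;> ring
  rw [this, Complex.ofReal_re]

lemma continuous_noise {T : Type*} [TopologicalSpace T] (tde tda : ℝ) {f : T → ℝ} {ρ : T → Op}
    (hf : Continuous f) (hρ : Continuous ρ) :
    Continuous fun x => noise tde tda (f x) (ρ x) := by
  have h0 : Continuous fun x =>
      (!![1, 0; 0, (Real.sqrt (1 - (1 - Real.exp (-f x / tda))) : ℂ)] : Op) := by
    refine continuous_matrix fun i j => ?_
    fin_cases i <;> fin_cases j <;> simp <;> fun_prop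
  have h1 : Continuous fun x =>
      (!![0, (Real.sqrt (1 - Real.exp (-f x / tda)) : ℂ); 0, 0] : Op) := by
    refine continuous_matrix fun i j => ?_
    fin_cases i <;> fin_cases j <;> simp <;> fun_prop
  have h2 := ((h0.matrix_mul hρ).matrix_mul h0.matrix_conjTranspose).add
    ((h1.matrix_mul hρ).matrix_mul h1.matrix_conjTranspose)
  have h3 : Continuous fun x => ((1 - Real.exp (-f x / tde)) / 2 : ℝ) := by fun_prop
  exact ((Complex.continuous_ofReal.comp (continuous_const.sub h3)).smul h2).add
    ((Complex.continuous_ofReal.comp h3).smul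
      ((continuous_const.matrix_mul h2).matrix_mul continuous_const))

lemma continuous_bobConditional (φ : Fin 2 → ℂ) (l k : Fin 2) :
    Continuous fun w : ℝ => bobConditional φ w l k := by
  refine continuous_matrix fun i j => ?_
  simp only [bobConditional_apply, werner_apply]
  fun_prop

/-- Needed only for the measurability of Bob's result, which compares a seed with this probability.
-/
lemma continuous_bornProb_teleported (tde tda : ℝ) (φ : Fin 2 → ℂ) (a : Bool) (b : Fin 2) :
    Continuous fun x : ℝ × ℝ => bornProb (teleported tde tda φ x.1 x.2) a b := by
  have h : Continuous fun x : ℝ × ℝ => teleported tde tda φ x.1 x.2 :=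
    continuous_finsetSum _ fun l _ => continuous_finsetSum _ fun k _ =>
      (continuous_const.matrix_mul (continuous_noise tde tda continuous_snd
        ((continuous_bobConditional φ l k).comp continuous_fst))).matrix_mul continuous_const
  exact Complex.continuous_re.comp
    (continuous_const.dotProduct (h.matrix_mulVec continuous_const))

/-! ### Independent trials up to the first success -/

lemma lintegral_infinitePi_prod {Ω : Type*} [MeasurableSpace Ω] (μ : Measure Ω)
    [IsProbabilityMeasure μ] (s : Finset ℕ) (f : ℕ → Ω → ℝ≥0∞) (hf : ∀ i, Measurable (f i)) :
    ∫⁻ ω, ∏ i ∈ s, f i (ω i) ∂(Measure.infinitePi fun _ : ℕ => μ) = ∏ i ∈ s, ∫⁻ x, f i x ∂μ := by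
  rw [lintegral_prod_eq_prod_lintegral_of_indepFun s (fun i (ω : ℕ → Ω) => f i (ω i))
    (iIndepFun_infinitePi hf) (fun i => (hf i).comp (measurable_pi_apply i))]
  refine Finset.prod_congr rfl fun i _ => ?_
  exact (measurePreserving_eval_infinitePi (fun _ : ℕ => μ) i).lintegral_comp (hf i)

lemma lintegral_pi_prod {ι Ω : Type*} [Fintype ι] [MeasurableSpace Ω] (μ : Measure Ω)
    [IsProbabilityMeasure μ] (f : ι → Ω → ℝ≥0∞) (hf : ∀ i, Measurable (f i)) :
    ∫⁻ ω, ∏ i, f i (ω i) ∂(Measure.pi fun _ : ι => μ) = ∏ i, ∫⁻ x, f i x ∂μ := by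
  rw [lintegral_prod_eq_prod_lintegral_of_indepFun Finset.univ (fun i (ω : ι → Ω) => f i (ω i))
    (iIndepFun_pi fun i => (hf i).aemeasurable) (fun i => (hf i).comp (measurable_pi_apply i))]
  refine Finset.prod_congr rfl fun i _ => ?_
  exact (measurePreserving_eval (fun _ : ι => μ) i).lintegral_comp (hf i)

lemma firstSuccess_mem {ok : ℕ → Prop} (h : ∃ k, ok k) : ok (firstSuccess ok) :=
  Nat.sInf_mem h

lemma not_of_lt_firstSuccess {ok : ℕ → Prop} {k : ℕ} (h : k < firstSuccess ok) : ¬ ok k :=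
  Nat.notMem_of_lt_sInf h

/-- The second alternative is the default `sInf ∅ = 0`: without any success the index is `0`. -/
lemma firstSuccess_eq_iff {ok : ℕ → Prop} {k : ℕ} :
    firstSuccess ok = k ↔ (ok k ∧ ∀ j < k, ¬ ok j) ∨ (k = 0 ∧ ∀ j, ¬ ok j) := by
  constructor
  · rintro rfl
    by_cases h : ∃ k, ok k
    · exact Or.inl ⟨firstSuccess_mem h, fun j hj => not_of_lt_firstSuccess hj⟩
    · push Not at h
      refine Or.inr ⟨?_, h⟩
      have : {k | ok k} = ∅ := by ext k; simp [h k]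
      rw [firstSuccess, this, Nat.sInf_empty]
  · rintro (⟨h1, h2⟩ | ⟨rfl, h⟩)
    · refine le_antisymm (Nat.sInf_le h1) ?_
      by_contra! hlt
      exact h2 _ hlt (firstSuccess_mem ⟨k, h1⟩)
    · have : {k | ok k} = ∅ := by ext k; simp [h k]
      rw [firstSuccess, this, Nat.sInf_empty]

section FirstSuccess

variable {Ω : Type*} [MeasurableSpace Ω] {ok : Ω → Prop}

lemma measurable_firstSuccess (hok : MeasurableSet {x | ok x}) :
    Measurable fun ω : ℕ → Ω => firstSuccess fun k => ok (ω k) := by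
  have h (j : ℕ) : MeasurableSet {ω : ℕ → Ω | ok (ω j)} := measurable_pi_apply j hok
  refine measurable_to_countable' fun k => ?_
  have : (fun ω : ℕ → Ω => firstSuccess fun k => ok (ω k)) ⁻¹' {k} =
      ({ω | ok (ω k)} ∩ ⋂ j : Set.Iio k, {ω | ok (ω j)}ᶜ) ∪
        ({_ω | k = 0} ∩ ⋂ j, {ω | ok (ω j)}ᶜ) := by
    ext ω
    simp [firstSuccess_eq_iff]
  rw [this]
  refine ((h k).inter (MeasurableSet.iInter fun j : Set.Iio k => (h j).compl)).union ?_
  exact (MeasurableSet.const _).inter (MeasurableSet.iInter fun j => (h j).compl)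

/-- Indices form a countable discrete space, so evaluation is jointly measurable in index and
sequence, and a random index may be substituted. -/
lemma measurable_apply_index {N : (ℕ → Ω) → ℕ} (hN : Measurable N) :
    Measurable fun ω : ℕ → Ω => ω (N ω) := by
  have : Measurable fun p : ℕ × (ℕ → Ω) => p.2 p.1 :=
    measurable_from_prod_countable_right fun k => measurable_pi_apply k
  exact this.comp (hN.prodMk measurable_id)

lemma measurable_sum_range_index {N : (ℕ → Ω) → ℕ} (hN : Measurable N) {f : Ω → ℝ}
    (hf : Measurable f) : Measurable fun ω : ℕ → Ω => ∑ j ∈ Finset.range (N ω), f (ω j) := by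
  have : Measurable fun p : ℕ × (ℕ → Ω) => ∑ j ∈ Finset.range p.1, f (p.2 j) :=
    measurable_from_prod_countable_right fun k => by
      change Measurable fun y : ℕ → Ω => ∑ j ∈ Finset.range k, f (y j)
      fun_prop
  exact this.comp (hN.prodMk measurable_id)

variable (μ : Measure Ω) [IsProbabilityMeasure μ]

/-- For every `k`, having no success at all lies in the cylinder of `k` initial failures, whose
probability is the `k`-th power of a number below 1. -/
lemma ae_exists_success (hok : MeasurableSet {x | ok x}) (hpos : μ {x | ok x} ≠ 0) :
    ∀ᵐ ω ∂(Measure.infinitePi fun _ : ℕ => μ), ∃ k, ok (ω k) := by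
  have hlt : μ {x | ok x}ᶜ < 1 := by
    rw [prob_compl_eq_one_sub hok]
    exact ENNReal.sub_lt_self ENNReal.one_ne_top one_ne_zero hpos
  rw [ae_iff, ← nonpos_iff_eq_zero]
  refine ge_of_tendsto' (ENNReal.tendsto_pow_atTop_nhds_zero_of_lt_one hlt) fun k => ?_
  calc _ ≤ (Measure.infinitePi fun _ : ℕ => μ)
        (Set.pi (Finset.range k) fun _ => {x | ok x}ᶜ) := by
        refine measure_mono fun ω hω => ?_
        simp only [not_exists, Set.mem_ofPred_eq] at hω
        exact fun j _ => hω j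
    _ = _ := by
        rw [Measure.infinitePi_pi _ (fun _ _ => hok.compl)]
        simp

/-- Expectation of a product over a geometric number of failures, followed by a success. -/
theorem lintegral_firstSuccess (hok : MeasurableSet {x | ok x}) (hpos : μ {x | ok x} ≠ 0)
    {g h : Ω → ℝ≥0∞} (hg : Measurable g) (hh : Measurable h) :
    ∫⁻ ω, (∏ j ∈ Finset.range (firstSuccess fun k => ok (ω k)), g (ω j)) *
        h (ω (firstSuccess fun k => ok (ω k))) ∂(Measure.infinitePi fun _ : ℕ => μ) =
      (1 - ∫⁻ x in {x | ok x}ᶜ, g x ∂μ)⁻¹ * ∫⁻ x in {x | ok x}, h x ∂μ := by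
  set S := {x | ok x} with hS
  -- The integrand becomes a sum over the candidate index `k` of products of one-coordinate
  -- functions. Only `k = N` survives: for `k < N` coordinate `k` is a failure where a success is
  -- demanded, for `k > N` coordinate `N` is a success where a failure is demanded.
  have key : ∀ᵐ ω ∂(Measure.infinitePi fun _ : ℕ => μ),
      (∏ j ∈ Finset.range (firstSuccess fun k => ok (ω k)), g (ω j)) *
        h (ω (firstSuccess fun k => ok (ω k))) =
      ∑' k, ∏ j ∈ Finset.range (k + 1),
        (if j < k then Sᶜ.indicator g (ω j) else S.indicator h (ω j)) := by
    filter_upwards [ae_exists_success μ hok hpos] with ω hω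
    set N := firstSuccess fun k => ok (ω k) with hN
    have hNok : ω N ∈ S := firstSuccess_mem (ok := fun k => ok (ω k)) hω
    have hlt (j : ℕ) (hj : j < N) : ω j ∈ Sᶜ :=
      not_of_lt_firstSuccess (ok := fun k => ok (ω k)) hj
    rw [tsum_eq_single N]
    · rw [Finset.prod_range_succ, if_neg (lt_irrefl _), Set.indicator_of_mem hNok]
      congr 1
      refine Finset.prod_congr rfl fun j hj => ?_
      rw [Finset.mem_range] at hj
      rw [if_pos hj, Set.indicator_of_mem (hlt j hj)]
    · intro k hk
      rcases lt_or_gt_of_ne hk with hk | hk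
      · refine Finset.prod_eq_zero (Finset.self_mem_range_succ k) ?_
        rw [if_neg (lt_irrefl _), Set.indicator_of_notMem (hlt k hk)]
      · refine Finset.prod_eq_zero (Finset.mem_range.2 (hk.trans (Nat.lt_succ_self k))) ?_
        rw [if_pos hk, Set.indicator_of_notMem (by simpa using hNok)]
  have hm (k j : ℕ) : Measurable fun x => if j < k then Sᶜ.indicator g x else S.indicator h x := by
    split_ifs
    · exact hg.indicator hok.compl
    · exact hh.indicator hok
  rw [lintegral_congr_ae key, lintegral_tsum]
  -- By independence the `k`-th term integrates to the `k`-th power of the failure weight times the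
  -- success weight. The geometric sum in `ℝ≥0∞` is valid for every ratio, with value `⊤` from 1 on.
  · rw [← ENNReal.tsum_geometric, ← ENNReal.tsum_mul_right]
    refine tsum_congr fun k => ?_
    rw [lintegral_infinitePi_prod μ _
      (fun j x => if j < k then Sᶜ.indicator g x else S.indicator h x) (hm k),
      Finset.prod_range_succ]
    simp only [lt_irrefl, if_false, lintegral_indicator hok]
    congr 1
    rw [Finset.prod_congr rfl (g := fun _ => ∫⁻ x in Sᶜ, g x ∂μ)]
    · simp
    · intro j hj
      rw [Finset.mem_range] at hj
      simp only [if_pos hj]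
      rw [lintegral_indicator hok.compl]
  · intro k
    exact (Finset.measurable_prod _ fun j _ =>
      (hm k j).comp (measurable_pi_apply j)).aemeasurable

end FirstSuccess

/-! ### Transforms with values in `[0, ∞]` -/

/-- The moment generating function with values in `[0, ∞]`. -/
noncomputable def lmgf {Ω : Type*} [MeasurableSpace Ω] (f : Ω → ℝ) (μ : Measure Ω) (t : ℝ) : ℝ≥0∞ :=
  ∫⁻ x, ENNReal.ofReal (Real.exp (t * f x)) ∂μ

section lmgf

variable {Ω : Type*} [MeasurableSpace Ω] {f : Ω → ℝ} {μ : Measure Ω}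

lemma integrable_iff_lintegral_ofReal_ne_top (hf : Measurable f) (h0 : ∀ x, 0 ≤ f x) :
    Integrable f μ ↔ ∫⁻ x, ENNReal.ofReal (f x) ∂μ ≠ ⊤ := by
  rw [← lt_top_iff_ne_top, Integrable, hasFiniteIntegral_iff_ofReal (ae_of_all _ h0)]
  exact and_iff_right hf.aestronglyMeasurable

lemma integrable_exp_iff_lmgf (hf : Measurable f) (t : ℝ) :
    Integrable (fun x => Real.exp (t * f x)) μ ↔ lmgf f μ t ≠ ⊤ :=
  integrable_iff_lintegral_ofReal_ne_top (by fun_prop) fun _ => (Real.exp_pos _).le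

/-- No integrability is required: in the divergent case the Bochner integral and `⊤.toReal` are both
`0`. -/
lemma mgf_eq_toReal_lmgf (hf : Measurable f) (t : ℝ) : mgf f μ t = (lmgf f μ t).toReal :=
  integral_eq_lintegral_of_nonneg_ae (ae_of_all _ fun _ => (Real.exp_pos _).le)
    (by fun_prop : Measurable fun x => Real.exp (t * f x)).aestronglyMeasurable

/-- Excludes the products `0 * ⊤ = 0`, which would hide an infinite factor. -/
lemma lmgf_ne_zero [NeZero μ] (hf : Measurable f) (t : ℝ) : lmgf f μ t ≠ 0 := by
  rw [lmgf, Ne, lintegral_eq_zero_iff (by fun_prop)]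
  intro h
  obtain ⟨x, hx⟩ := h.exists
  exact (ENNReal.ofReal_pos.2 (Real.exp_pos (t * f x))).ne' hx

/-- Transfers finiteness from `t` to the smaller arguments `t - 1/tc`, `t - 1/tda` and so on in the
formula for `m₁`. -/
lemma lmgf_anti (h0 : ∀ᵐ x ∂μ, 0 ≤ f x) {s t : ℝ} (hst : s ≤ t) : lmgf f μ s ≤ lmgf f μ t := by
  refine lintegral_mono_ae ?_
  filter_upwards [h0] with x hx
  gcongr

end lmgf

/-! ### Durations of links and swap trials, and the Werner parameter -/

lemma ae_nonneg_seLaw {rate shift : ℝ} (hs : 0 ≤ shift) : ∀ᵐ x ∂seLaw rate shift, 0 ≤ x := by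
  rw [seLaw, ae_map_iff (by fun_prop) measurableSet_Ici]
  have : ∀ᵐ x ∂expMeasure rate, 0 ≤ x := by
    rw [ae_iff]
    simp only [not_le]
    change expMeasure rate (Set.Iio 0) = 0
    rw [expMeasure, gammaMeasure, withDensity_apply _ measurableSet_Iio]
    exact lintegral_gammaPDF_of_nonpos le_rfl
  filter_upwards [this] with x hx
  positivity

lemma lintegral_bernoulliMeasure (p : unitInterval) (f : Bool → ℝ≥0∞) :
    ∫⁻ b, f b ∂bernoulliMeasure true false p =
      ENNReal.ofReal p * f true + ENNReal.ofReal (1 - p) * f false := by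
  rw [bernoulliMeasure_def, lintegral_add_measure, lintegral_smul_measure, lintegral_smul_measure,
    lintegral_dirac, lintegral_dirac]
  have h1 : ENNReal.ofReal p = (unitInterval.toNNReal p : ℝ≥0∞) := by
    rw [← ENNReal.ofReal_coe_nnreal]; rfl
  have h2 : ENNReal.ofReal (1 - p) = (unitInterval.toNNReal (unitInterval.symm p) : ℝ≥0∞) := by
    rw [← ENNReal.ofReal_coe_nnreal]; rfl
  rw [h1, h2]
  rfl

lemma measurableSet_flag {Ω : Type*} [MeasurableSpace Ω] {f : Ω → Bool} (hf : Measurable f) :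
    MeasurableSet {x | f x = true} := hf (measurableSet_singleton true)

@[fun_prop]
lemma measurable_linkIdx : Measurable linkIdx :=
  measurable_firstSuccess (ok := fun x : LinkTrial => x.2.2 = true)
    (measurableSet_flag (by fun_prop))

@[fun_prop]
lemma measurable_tC : Measurable tC :=
  (by fun_prop : Measurable fun x : LinkTrial => x.2.1).comp
    (measurable_apply_index measurable_linkIdx)

@[fun_prop]
lemma measurable_tH : Measurable tH :=
  (measurable_sum_range_index (f := fun x : LinkTrial => x.1) (measurable_linkIdx.add_const 1)
    (by fun_prop)).add
  (measurable_sum_range_index (f := fun x : LinkTrial => x.2.1) measurable_linkIdx (by fun_prop))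

@[fun_prop]
lemma measurable_v : Measurable v := measurable_tH.add measurable_tC

@[fun_prop]
lemma measurable_vMax : Measurable vMax := by unfold vMax; fun_prop

@[fun_prop]
lemma measurable_tC' : Measurable tC' := by unfold tC'; fun_prop

variable (P : Params)

@[fun_prop]
lemma measurable_endWerner : Measurable (endWerner P) := by unfold endWerner; fun_prop

/-- `|V_A - V_B| + T_CA + T_CB`: the total storage time of the two elementary links. -/
noncomputable def storage (s : SwapTrial) : ℝ := |v s.1 - v s.2.1| + tC s.1 + tC s.2.1

@[fun_prop]
lemma measurable_storage : Measurable storage := by unfold storage; fun_prop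

/-- The two storage times `max - T_HA` and `max - T_HB` add up to `|V_A - V_B| + T_CA + T_CB`,
because `|a - b| = 2 * max a b - a - b` and `V = T_H + T_C`. -/
lemma endWerner_eq (s : SwapTrial) :
    endWerner P s = P.w0 ^ 2 * Real.exp (-storage s * P.tc⁻¹) * Real.exp (-(1 / P.tc) * tC' s) := by
  have h : -storage s * P.tc⁻¹ = -(vMax s - tH s.1) / P.tc + -(vMax s - tH s.2.1) / P.tc := by
    have : |v s.1 - v s.2.1| = 2 * vMax s - v s.1 - v s.2.1 := by
      rw [vMax]
      rcases le_total (v s.1) (v s.2.1) with h | h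
      · rw [max_eq_right h, abs_of_nonpos (by linarith)]; ring
      · rw [max_eq_left h, abs_of_nonneg (by linarith)]; ring
    rw [storage, this, v, v]
    ring
  rw [h, Real.exp_add, endWerner]
  have : -(1 / P.tc) * tC' s = -tC' s / P.tc := by ring
  rw [this]
  ring

lemma ae_nonneg_tC : ∀ᵐ r ∂linkRunLaw P, 0 ≤ tC r := by
  have h : ∀ᵐ x ∂linkTrialLaw P, 0 ≤ x.2.1 :=
    Measure.quasiMeasurePreserving_snd.ae
      (Measure.quasiMeasurePreserving_fst.ae (ae_nonneg_seLaw P.shiftCom_nonneg))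
  have : ∀ᵐ r ∂linkRunLaw P, ∀ k, 0 ≤ (r k).2.1 := ae_all_iff.2 fun k =>
    (measurePreserving_eval_infinitePi (fun _ : ℕ => linkTrialLaw P) k).quasiMeasurePreserving.ae h
  filter_upwards [this] with r hr using hr _

lemma ae_nonneg_swapTrial : ∀ᵐ s ∂swapTrialLaw P, 0 ≤ storage s ∧ 0 ≤ tC' s := by
  have h1 : ∀ᵐ s ∂swapTrialLaw P, 0 ≤ tC s.1 :=
    Measure.quasiMeasurePreserving_fst.ae (ae_nonneg_tC P)
  have h2 : ∀ᵐ s ∂swapTrialLaw P, 0 ≤ tC s.2.1 :=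
    Measure.quasiMeasurePreserving_snd.ae (Measure.quasiMeasurePreserving_fst.ae (ae_nonneg_tC P))
  have h3 : ∀ᵐ s ∂swapTrialLaw P, 0 ≤ tC' s :=
    Measure.quasiMeasurePreserving_snd.ae (Measure.quasiMeasurePreserving_snd.ae
      (Measure.quasiMeasurePreserving_fst.ae (ae_nonneg_seLaw P.shiftSwap_nonneg)))
  filter_upwards [h1, h2, h3] with s h1 h2 h3
  exact ⟨by rw [storage]; positivity, h3⟩

/-- Each link contributes one factor `w₀`, so a negative `w₀` is harmless. -/
lemma endWerner_nonneg (s : SwapTrial) : 0 ≤ endWerner P s := by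
  rw [endWerner_eq]; positivity

lemma endWerner_le_one {s : SwapTrial} (h : 0 ≤ storage s ∧ 0 ≤ tC' s) : endWerner P s ≤ 1 := by
  have h0 := P.tc_pos
  have h1 : P.w0 ^ 2 ≤ 1 := by nlinarith [P.neg_third_le_w0, P.w0_le_one]
  have h2 : Real.exp (-storage s * P.tc⁻¹) ≤ 1 := by
    rw [Real.exp_le_one_iff, neg_mul, neg_nonpos]; exact mul_nonneg h.1 (by positivity)
  have h3 : Real.exp (-(1 / P.tc) * tC' s) ≤ 1 := by
    rw [Real.exp_le_one_iff, neg_mul, neg_nonpos]; exact mul_nonneg (by positivity) h.2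
  rw [endWerner_eq]
  exact mul_le_one₀ (mul_le_one₀ h1 (Real.exp_pos _).le h2) (Real.exp_pos _).le h3

/-- `I(t, 1/c)` with values in `[0, ∞]`. -/
noncomputable def lI (t c : ℝ) : ℝ≥0∞ :=
  ∫⁻ s, ENNReal.ofReal (Real.exp (t * vMax s) * Real.exp (-storage s * c)) ∂swapTrialLaw P

lemma I_eq_toReal_lI (t : ℝ) (s : EReal) : I P t s = (lI P t (s⁻¹).toReal).toReal :=
  integral_eq_lintegral_of_nonneg_ae (ae_of_all _ fun _ => by positivity)
    (by fun_prop : Measurable fun s => Real.exp (t * vMax s) * Real.exp (-storage s * _)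
      ).aestronglyMeasurable

lemma lI_zero (t : ℝ) : lI P t 0 = lmgf vMax (swapTrialLaw P) t := by
  simp [lI, lmgf]

lemma lI_anti {t c : ℝ} (hc : 0 ≤ c) : lI P t c ≤ lmgf vMax (swapTrialLaw P) t := by
  refine lintegral_mono_ae ?_
  filter_upwards [ae_nonneg_swapTrial P] with s hs
  refine ENNReal.ofReal_le_ofReal (mul_le_of_le_one_right (Real.exp_pos _).le ?_)
  rw [Real.exp_le_one_iff, neg_mul, neg_nonpos]
  exact mul_nonneg hs.1 hc

/-- Independence of the pair of links, the communication phase and the success flag. An indicator as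
`b` yields the integrals over successful and over failed trials. -/
lemma lintegral_swapTrialLaw_mul {f : LinkRun × LinkRun → ℝ≥0∞} {g : ℝ → ℝ≥0∞} {b : Bool → ℝ≥0∞}
    (hf : Measurable f) (hg : Measurable g) :
    ∫⁻ s, f (s.1, s.2.1) * (g s.2.2.1 * b s.2.2.2) ∂swapTrialLaw P =
      (∫⁻ s, f (s.1, s.2.1) ∂swapTrialLaw P) * ((∫⁻ x, g x ∂swapComLaw P) *
        (ENNReal.ofReal P.pSwap * b true + ENNReal.ofReal (1 - P.pSwap) * b false)) := by
  have hb : Measurable b := measurable_from_top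
  have key (k : ℝ × Bool → ℝ≥0∞) (hk : Measurable k) :
      ∫⁻ s, f (s.1, s.2.1) * k s.2.2 ∂swapTrialLaw P =
        (∫⁻ r, ∫⁻ r', f (r, r') ∂linkRunLaw P ∂linkRunLaw P) * ∫⁻ z, k z ∂((swapComLaw P).prod
          (bernoulliMeasure true false ⟨P.pSwap, P.pSwap_pos.le, P.pSwap_le_one⟩)) := by
    rw [swapTrialLaw, lintegral_prod _ (by fun_prop), ← lintegral_mul_const _ (by fun_prop)]
    refine lintegral_congr fun r => ?_
    exact lintegral_prod_mul (f := fun r' => f (r, r')) (by fun_prop) hk.aemeasurable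
  -- Taking `k = 1` identifies the iterated integral over the two links with the integral of `f`
  -- over a whole swap trial.
  have h1 := key (fun _ => 1) measurable_const
  simp only [mul_one, lintegral_one, measure_univ] at h1
  rw [key (fun z => g z.1 * b z.2) (by fun_prop), h1,
    lintegral_prod_mul hg.aemeasurable hb.aemeasurable, lintegral_bernoulliMeasure]

lemma measurableSet_swapSuccess : MeasurableSet {s : SwapTrial | s.2.2.2 = true} :=
  measurableSet_flag (by fun_prop)

lemma setLIntegral_swapSuccess {f : LinkRun × LinkRun → ℝ≥0∞} {g : ℝ → ℝ≥0∞}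
    (hf : Measurable f) (hg : Measurable g) :
    ∫⁻ s in {s | s.2.2.2 = true}, f (s.1, s.2.1) * g s.2.2.1 ∂swapTrialLaw P =
      ENNReal.ofReal P.pSwap *
        ((∫⁻ s, f (s.1, s.2.1) ∂swapTrialLaw P) * ∫⁻ x, g x ∂swapComLaw P) := by
  have h := lintegral_swapTrialLaw_mul P hf hg (b := fun c => if c then 1 else 0)
  simp only [if_true, Bool.false_eq_true, if_false, mul_one, mul_zero, add_zero] at h
  rw [← lintegral_indicator measurableSet_swapSuccess]
  rw [mul_comm, mul_assoc, ← h]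
  refine lintegral_congr fun s => ?_
  by_cases hs : s.2.2.2 = true <;> simp [Set.indicator, hs]

lemma setLIntegral_swapFailure {f : LinkRun × LinkRun → ℝ≥0∞} {g : ℝ → ℝ≥0∞}
    (hf : Measurable f) (hg : Measurable g) :
    ∫⁻ s in {s | s.2.2.2 = true}ᶜ, f (s.1, s.2.1) * g s.2.2.1 ∂swapTrialLaw P =
      ENNReal.ofReal (1 - P.pSwap) *
        ((∫⁻ s, f (s.1, s.2.1) ∂swapTrialLaw P) * ∫⁻ x, g x ∂swapComLaw P) := by
  have h := lintegral_swapTrialLaw_mul P hf hg (b := fun c => if c then 0 else 1)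
  simp only [if_true, Bool.false_eq_true, if_false, mul_one, mul_zero, zero_add] at h
  rw [← lintegral_indicator measurableSet_swapSuccess.compl]
  rw [mul_comm, mul_assoc, ← h]
  refine lintegral_congr fun s => ?_
  by_cases hs : s.2.2.2 = true <;> simp [Set.indicator, hs]

lemma swapTrialLaw_success : swapTrialLaw P {s | s.2.2.2 = true} = ENNReal.ofReal P.pSwap := by
  simpa using setLIntegral_swapSuccess P (f := fun _ => 1) (g := fun _ => 1) measurable_const
    measurable_const

lemma swapTrialLaw_success_ne_zero : swapTrialLaw P {s | s.2.2.2 = true} ≠ 0 := by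
  rw [swapTrialLaw_success]
  exact (ENNReal.ofReal_pos.2 P.pSwap_pos).ne'

/-! ### Uniform choices and Bob's result -/

lemma lintegral_uniformOn_finset {Ω : Type*} [MeasurableSpace Ω] [MeasurableSingletonClass Ω]
    (s : Finset Ω) (f : Ω → ℝ≥0∞) :
    ∫⁻ x, f x ∂uniformOn (s : Set Ω) = (s.card : ℝ≥0∞)⁻¹ * ∑ x ∈ s, f x := by
  rw [uniformOn, ProbabilityTheory.cond, lintegral_smul_measure, lintegral_finset,
    Measure.count_apply_finset, smul_eq_mul]
  simp

lemma lintegral_uniformOn_univ {Ω : Type*} [Fintype Ω] [MeasurableSpace Ω]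
    [MeasurableSingletonClass Ω] (f : Ω → ℝ≥0∞) :
    ∫⁻ x, f x ∂uniformOn (Set.univ : Set Ω) = (Fintype.card Ω : ℝ≥0∞)⁻¹ * ∑ x, f x := by
  have := lintegral_uniformOn_finset (Finset.univ : Finset Ω) f
  rwa [Finset.coe_univ] at this

lemma measurePreserving_not :
    MeasurePreserving not (uniformOn (Set.univ : Set Bool)) (uniformOn Set.univ) := by
  refine ⟨measurable_from_top, Measure.ext_of_singleton fun b => ?_⟩
  rw [Measure.map_apply measurable_from_top (measurableSet_singleton b)]
  have : not ⁻¹' {b} = {!b} := by ext c; cases b <;> cases c <;> simp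
  rw [this, uniformOn_univ, uniformOn_univ, Measure.count_singleton, Measure.count_singleton]

/-- Bob's result in the basis `b`, for a Werner parameter `w` and a communication time `x`. -/
noncomputable def outcome (P : Params) (w x : ℝ) (bit : Fin 2) (basis : Bool) (u : unitInterval)
    (b : Bool) : Fin 2 :=
  if (u : ℝ) < bornProb (teleported P.tde P.tda (basisVec basis bit) w x) b 0 then 0 else 1

variable (P : Params)

lemma measurable_outcome : Measurable fun y : (Fin 2 × Bool × Bool) × ℝ × ℝ × unitInterval =>
    outcome P y.2.1 y.2.2.1 y.1.1 y.1.2.1 y.2.2.2 y.1.2.2 := by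
  refine measurable_from_prod_countable_right fun ⟨bit, basis, b⟩ => ?_
  change Measurable fun y : ℝ × ℝ × unitInterval => outcome P y.1 y.2.1 bit basis y.2.2 b
  have h := (continuous_bornProb_teleported P.tde P.tda (basisVec basis bit) b 0).measurable
  have h' : Measurable fun y : ℝ × ℝ × unitInterval =>
      bornProb (teleported P.tde P.tda (basisVec basis bit) y.1 y.2.1) b 0 :=
    h.comp (g := fun x : ℝ × ℝ =>
        bornProb (teleported P.tde P.tda (basisVec basis bit) x.1 x.2) b 0)
      (f := fun y : ℝ × ℝ × unitInterval => (y.1, y.2.1))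
      (measurable_fst.prodMk (measurable_fst.comp measurable_snd))
  exact Measurable.ite (measurableSet_lt (measurable_subtype_coe.comp
    (measurable_snd.comp measurable_snd)) h') measurable_const measurable_const

lemma _root_.Measurable.outcome {Ω : Type*} [MeasurableSpace Ω] {w x : Ω → ℝ} {bit : Ω → Fin 2}
    {basis b : Ω → Bool} {u : Ω → unitInterval} (hw : Measurable w) (hx : Measurable x)
    (hbit : Measurable bit) (hbasis : Measurable basis) (hu : Measurable u) (hb : Measurable b) :
    Measurable fun ω => outcome P (w ω) (x ω) (bit ω) (basis ω) (u ω) (b ω) :=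
  (measurable_outcome P).comp ((hbit.prodMk (hbasis.prodMk hb)).prodMk (hw.prodMk (hx.prodMk hu)))

lemma volume_coe_lt {b : ℝ} (h0 : 0 ≤ b) (h1 : b ≤ 1) :
    volume {u : unitInterval | (u : ℝ) < b} = ENNReal.ofReal b := by
  exact unitInterval.volume_Iio (⟨b, h0, h1⟩ : unitInterval)

/-- Given the Werner parameter `w` and the communication time `x`, the probability that Bob reads
Alice's bit in Alice's basis. -/
noncomputable def agreeProb (w x : ℝ) : ℝ :=
  1 / 4 * (2 + w * (Real.exp (-x / P.tda) + Real.exp (-x / P.tde - x / (2 * P.tda))))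

/-- For bit `0` agreement means that the seed is below `(1 + w * e) / 2`, for bit `1` that it is not
below `(1 - w * e) / 2`; both events have the same length. The bounds on `w` and `x` keep the
thresholds in `[0, 1]`. -/
lemma volume_outcome_eq {w x : ℝ} (hw0 : 0 ≤ w) (hw1 : w ≤ 1) (hx : 0 ≤ x) (bit : Fin 2)
    (basis : Bool) :
    volume {u : unitInterval | outcome P w x bit basis u basis = bit} =
      ENNReal.ofReal (1 / 2 * (1 + w *
        if basis then Real.exp (-x / P.tde - x / (2 * P.tda)) else Real.exp (-x / P.tda))) := by
  have htda := P.tda_pos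
  have htde := P.tde_pos
  set e := if basis then Real.exp (-x / P.tde - x / (2 * P.tda)) else Real.exp (-x / P.tda)
    with he
  have he0 : 0 ≤ e := by rw [he]; split_ifs <;> positivity
  have he1 : e ≤ 1 := by
    have h1 : 0 ≤ x / P.tde := by positivity
    have h2 : 0 ≤ x / P.tda := by positivity
    have h3 : 0 ≤ x / (2 * P.tda) := by positivity
    rw [he]
    split_ifs <;> rw [Real.exp_le_one_iff, neg_div] <;> linarith
  have h0 : 0 ≤ w * e := mul_nonneg hw0 he0
  have h1 : w * e ≤ 1 := mul_le_one₀ hw1 he0 he1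
  have hb := bornProb_teleported P.tde P.tda x w (by positivity) basis bit
  rw [← he] at hb
  simp only [outcome, hb]
  obtain rfl | rfl : bit = 0 ∨ bit = 1 := by omega
  · have : {u : unitInterval | (if (u : ℝ) < 1 / 2 * (1 + (-1) ^ (0 : Fin 2).val * (w * e)) then
        (0 : Fin 2) else 1) = 0} = {u : unitInterval | (u : ℝ) < 1 / 2 * (1 + w * e)} := by
      ext u; simp
    rw [this, volume_coe_lt (by linarith) (by linarith)]
  · have : {u : unitInterval | (if (u : ℝ) < 1 / 2 * (1 + (-1) ^ (1 : Fin 2).val * (w * e)) then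
        (0 : Fin 2) else 1) = 1} = {u : unitInterval | (u : ℝ) < 1 / 2 * (1 - w * e)}ᶜ := by
      ext u; simp [sub_eq_add_neg]
    rw [this, prob_compl_eq_one_sub (measurableSet_lt (by fun_prop) measurable_const),
      volume_coe_lt (by linarith) (by linarith), ← ENNReal.ofReal_one,
      ← ENNReal.ofReal_sub _ (by linarith)]
    congr 1
    ring

/-- The law of Alice's bit, the two bases and the seed. -/
noncomputable abbrev choiceLaw : Measure (Fin 2 × Bool × Bool × unitInterval) :=
  (uniformOn Set.univ).prod ((uniformOn Set.univ).prod ((uniformOn Set.univ).prod volume))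

lemma choiceLaw_agree {w x : ℝ} (hw0 : 0 ≤ w) (hw1 : w ≤ 1) (hx : 0 ≤ x) :
    ∫⁻ c, (if outcome P w x c.1 c.2.1 c.2.2.2 c.2.1 = c.1 then 1 else 0) ∂choiceLaw =
      ENNReal.ofReal (agreeProb P w x) := by
  have hm : Measurable fun c : Fin 2 × Bool × Bool × unitInterval =>
      (if outcome P w x c.1 c.2.1 c.2.2.2 c.2.1 = c.1 then 1 else 0 : ℝ≥0∞) :=
    Measurable.ite (measurableSet_eq_fun (Measurable.outcome P measurable_const measurable_const
      (by fun_prop) (by fun_prop) (by fun_prop) (by fun_prop)) (by fun_prop))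
      measurable_const measurable_const
  have hi (bit : Fin 2) (basis : Bool) :
      ∫⁻ u : unitInterval, (if outcome P w x bit basis u basis = bit then 1 else 0) =
      ENNReal.ofReal (1 / 2 * (1 + w *
        if basis then Real.exp (-x / P.tde - x / (2 * P.tda)) else Real.exp (-x / P.tda))) := by
    rw [← volume_outcome_eq P hw0 hw1 hx bit basis, ← lintegral_indicator_one]
    · refine lintegral_congr fun u => ?_
      simp [Set.indicator]
    · exact measurableSet_eq_fun (Measurable.outcome P measurable_const measurable_const
        measurable_const measurable_const measurable_id measurable_const) measurable_const
  rw [lintegral_prod _ hm.aemeasurable]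
  have h2 (bit : Fin 2) : ∫⁻ c : Bool × Bool × unitInterval,
      (if outcome P w x bit c.1 c.2.2 c.1 = bit then 1 else 0)
        ∂((uniformOn Set.univ).prod ((uniformOn Set.univ).prod volume)) =
      ENNReal.ofReal (agreeProb P w x) := by
    have hm2 : Measurable fun c : Bool × Bool × unitInterval =>
        (if outcome P w x bit c.1 c.2.2 c.1 = bit then 1 else 0 : ℝ≥0∞) :=
      hm.comp (measurable_const.prodMk measurable_id)
    rw [lintegral_prod _ hm2.aemeasurable]
    have h3 (basis : Bool) : ∫⁻ c : Bool × unitInterval,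
      (if outcome P w x bit basis c.2 basis = bit then 1 else 0)
        ∂((uniformOn Set.univ).prod volume) = ENNReal.ofReal (1 / 2 * (1 + w *
        if basis then Real.exp (-x / P.tde - x / (2 * P.tda)) else Real.exp (-x / P.tda))) := by
      have hm3 : Measurable fun c : Bool × unitInterval =>
          (if outcome P w x bit basis c.2 basis = bit then 1 else 0 : ℝ≥0∞) :=
        hm2.comp (measurable_const.prodMk measurable_id)
      rw [← hi bit basis, lintegral_prod _ hm3.aemeasurable]
      -- Bob's own basis plays no role when he measures in Alice's, so it is integrated out as a
      -- constant.
      refine (lintegral_const (μ := uniformOn (Set.univ : Set Bool)) (∫⁻ u : unitInterval,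
        (if outcome P w x bit basis u basis = bit then 1 else 0))).trans ?_
      rw [measure_univ, mul_one]
    simp only [h3]
    rw [lintegral_uniformOn_univ]
    simp only [Fintype.sum_bool, if_true, Bool.false_eq_true, if_false, Fintype.card_bool]
    rw [← ENNReal.ofReal_add (by positivity) (by positivity), Nat.cast_ofNat,
      ← ENNReal.ofReal_ofNat 2, ← ENNReal.ofReal_inv_of_pos (by norm_num),
      ← ENNReal.ofReal_mul (by norm_num), agreeProb]
    congr 1
    ring
  rw [lintegral_congr h2, lintegral_const, measure_univ, mul_one]

/-! ### Transforms of the teleportation time, with and without agreement -/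

variable (P : Params)

/-- The successful swap trial. -/
noncomputable def finalTrial (q : Qubit) : SwapTrial := q.1 (swapIdx q)

lemma result_eq_outcome (q : Qubit) (b : Bool) :
    result P q b = outcome P (endWerner P (finalTrial q)) (tC'' q) (aliceBit q) (aliceBasis q)
      q.2.2.2.2.2 b := rfl

lemma measurable_firstSwap :
    Measurable fun ω : ℕ → SwapTrial => firstSuccess fun j => (ω j).2.2.2 = true :=
  measurable_firstSuccess (ok := fun s : SwapTrial => s.2.2.2 = true) measurableSet_swapSuccess

@[fun_prop]
lemma measurable_finalTrial : Measurable finalTrial :=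
  (measurable_apply_index measurable_firstSwap).comp measurable_fst

@[fun_prop]
lemma measurable_tGamma : Measurable tGamma :=
  (measurable_sum_range_index (f := fun s : SwapTrial => vMax s + tC' s) measurable_firstSwap
    (by fun_prop)).comp measurable_fst

@[fun_prop]
lemma measurable_tC'' : Measurable tC'' := by unfold tC''; fun_prop

lemma X_eq (q : Qubit) : X q = tGamma q + vMax (finalTrial q) + tC' (finalTrial q) + tC'' q := rfl

@[fun_prop]
lemma measurable_X : Measurable X := by
  have : X = fun q => tGamma q + vMax (finalTrial q) + tC' (finalTrial q) + tC'' q := rfl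
  rw [this]
  fun_prop

@[fun_prop]
lemma measurable_aliceBit : Measurable aliceBit := by unfold aliceBit; fun_prop

@[fun_prop]
lemma measurable_aliceBasis : Measurable aliceBasis := by unfold aliceBasis; fun_prop

@[fun_prop]
lemma measurable_bobBasis : Measurable bobBasis := by unfold bobBasis; fun_prop

lemma measurable_result {b : Qubit → Bool} (hb : Measurable b) :
    Measurable fun q => result P q (b q) := by
  simp only [result_eq_outcome]
  exact Measurable.outcome P (by fun_prop) (by fun_prop) (by fun_prop) (by fun_prop)
    (by fun_prop) hb

lemma measurableSet_agree {b : Qubit → Bool} (hb : Measurable b) :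
    MeasurableSet {q | result P q (b q) = aliceBit q} :=
  measurableSet_eq_fun (measurable_result P hb) measurable_aliceBit

@[fun_prop]
lemma measurable_Y : Measurable (Y P) :=
  Measurable.ite (measurableSet_agree P measurable_aliceBasis) measurable_const measurable_const

lemma Y_eq_zero_or_one (q : Qubit) : Y P q = 0 ∨ Y P q = 1 := by
  unfold Y; split_ifs <;> simp

/-- `1 - p_swap` times `I(t, ∞)` times `M_{T_C'}(t)`, with values in `[0, ∞]`. -/
noncomputable def lFail (t : ℝ) : ℝ≥0∞ :=
  ENNReal.ofReal (1 - P.pSwap) *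
    (lmgf vMax (swapTrialLaw P) t * lmgf id (swapComLaw P) t)

lemma ofReal_exp_add (a b : ℝ) : ENNReal.ofReal (Real.exp (a + b)) =
    ENNReal.ofReal (Real.exp a) * ENNReal.ofReal (Real.exp b) := by
  rw [Real.exp_add, ENNReal.ofReal_mul (Real.exp_pos _).le]

/-- The geometric formula for swap trials: a failure weighs the exponential of its duration, and the
success weighs `h` averaged over the remaining coordinates, which are independent of the swap
trials. -/
lemma lintegral_tGamma_mul (t : ℝ) {h : SwapTrial × ℝ × Fin 2 × Bool × Bool × unitInterval → ℝ≥0∞}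
    (hh : Measurable h) :
    ∫⁻ q, ENNReal.ofReal (Real.exp (t * tGamma q)) * h (finalTrial q, q.2) ∂qubitLaw P =
      (1 - lFail P t)⁻¹ * ∫⁻ s in {s | s.2.2.2 = true},
        ∫⁻ z, h (s, z) ∂((abLaw P).prod choiceLaw) ∂swapTrialLaw P := by
  have hfail : ∫⁻ s in {s | s.2.2.2 = true}ᶜ,
      ENNReal.ofReal (Real.exp (t * (vMax s + tC' s))) ∂swapTrialLaw P = lFail P t := by
    rw [lFail, lmgf, lmgf]
    have := setLIntegral_swapFailure P
      (f := fun r => ENNReal.ofReal (Real.exp (t * max (v r.1) (v r.2))))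
      (g := fun x => ENNReal.ofReal (Real.exp (t * x))) (by fun_prop) (by fun_prop)
    simp only [← ofReal_exp_add, ← mul_add] at this
    exact this
  have hm : Measurable fun q : Qubit =>
      ENNReal.ofReal (Real.exp (t * tGamma q)) * h (finalTrial q, q.2) := by fun_prop
  rw [← hfail, ← lintegral_firstSuccess (swapTrialLaw P) (ok := fun s : SwapTrial => s.2.2.2 = true)
    measurableSet_swapSuccess (swapTrialLaw_success_ne_zero P) (by fun_prop)
    (hh.lintegral_prod_right'), qubitLaw, lintegral_prod _ hm.aemeasurable]
  refine lintegral_congr fun ω => ?_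
  set N := firstSuccess fun k => (ω k).2.2.2 = true with hN
  have h1 : ∏ j ∈ Finset.range N, ENNReal.ofReal (Real.exp (t * (vMax (ω j) + tC' (ω j)))) =
      ENNReal.ofReal (Real.exp (t * ∑ j ∈ Finset.range N, (vMax (ω j) + tC' (ω j)))) := by
    rw [Finset.mul_sum, Real.exp_sum, ENNReal.ofReal_prod_of_nonneg fun _ _ => (Real.exp_pos _).le]
  rw [h1, ← lintegral_const_mul _ (by fun_prop)]
  rfl

lemma lmgf_tGamma (t : ℝ) :
    lmgf tGamma (qubitLaw P) t = (1 - lFail P t)⁻¹ * ENNReal.ofReal P.pSwap := by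
  have := lintegral_tGamma_mul P t (h := fun _ => 1) measurable_const
  simpa [lmgf, swapTrialLaw_success] using this

lemma setLIntegral_exp (a b c : ℝ) :
    ∫⁻ s in {s | s.2.2.2 = true},
      ENNReal.ofReal (Real.exp (a * vMax s) * Real.exp (-storage s * b)) *
        ENNReal.ofReal (Real.exp (c * tC' s)) ∂swapTrialLaw P =
      ENNReal.ofReal P.pSwap * (lI P a b * lmgf id (swapComLaw P) c) :=
  setLIntegral_swapSuccess P
    (f := fun r => ENNReal.ofReal (Real.exp (a * max (v r.1) (v r.2)) *
      Real.exp (-(|v r.1 - v r.2| + tC r.1 + tC r.2) * b)))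
    (g := fun x => ENNReal.ofReal (Real.exp (c * x))) (by fun_prop) (by fun_prop)

lemma lmgf_X (t : ℝ) :
    lmgf X (qubitLaw P) t = (1 - lFail P t)⁻¹ * (ENNReal.ofReal P.pSwap *
      (lmgf vMax (swapTrialLaw P) t * lmgf id (swapComLaw P) t * lmgf id (abLaw P) t)) := by
  have h1 := lintegral_tGamma_mul P t (h := fun y => ENNReal.ofReal (Real.exp (t * vMax y.1)) *
    ENNReal.ofReal (Real.exp (t * tC' y.1)) * ENNReal.ofReal (Real.exp (t * y.2.1))) (by fun_prop)
  have h2 : lmgf X (qubitLaw P) t = ∫⁻ q, ENNReal.ofReal (Real.exp (t * tGamma q)) *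
      (ENNReal.ofReal (Real.exp (t * vMax (finalTrial q))) *
        ENNReal.ofReal (Real.exp (t * tC' (finalTrial q))) *
        ENNReal.ofReal (Real.exp (t * q.2.1))) ∂qubitLaw P := by
    refine lintegral_congr fun q => ?_
    rw [← ofReal_exp_add, ← ofReal_exp_add, ← ofReal_exp_add, X_eq, tC'']
    congr 2
    ring
  rw [h2, h1]
  congr 1
  have h3 (s : SwapTrial) : ∫⁻ z, ENNReal.ofReal (Real.exp (t * vMax s)) *
      ENNReal.ofReal (Real.exp (t * tC' s)) * ENNReal.ofReal (Real.exp (t * z.1))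
        ∂((abLaw P).prod choiceLaw) = ENNReal.ofReal (Real.exp (t * vMax s)) *
      ENNReal.ofReal (Real.exp (t * tC' s)) * lmgf id (abLaw P) t := by
    rw [lintegral_const_mul _ (by fun_prop)]
    congr 1
    exact measurePreserving_fst.lintegral_comp
      (f := fun x => ENNReal.ofReal (Real.exp (t * x))) (by fun_prop)
  simp only [h3]
  rw [lintegral_mul_const _ (by fun_prop)]
  have h4 := setLIntegral_exp P t 0 t
  simp only [mul_zero, Real.exp_zero, mul_one, lI_zero] at h4
  rw [h4]
  ring

/-- `m_1(t)` with values in `[0, ∞]`. -/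
noncomputable def lm1 (t : ℝ) : ℝ≥0∞ :=
  ∫⁻ q, ENNReal.ofReal (Real.exp (t * X q) * Y P q) ∂qubitLaw P

/-- `m_0(t)` with values in `[0, ∞]`. -/
noncomputable def lm0 (t : ℝ) : ℝ≥0∞ :=
  ∫⁻ q, ENNReal.ofReal (Real.exp (t * X q) * (1 - Y P q)) ∂qubitLaw P

lemma Y_nonneg (q : Qubit) : 0 ≤ Y P q := by
  rcases Y_eq_zero_or_one P q with h | h <;> simp [h]

lemma one_sub_Y_nonneg (q : Qubit) : 0 ≤ 1 - Y P q := by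
  rcases Y_eq_zero_or_one P q with h | h <;> simp [h]

lemma lm0_add_lm1 (t : ℝ) : lm0 P t + lm1 P t = lmgf X (qubitLaw P) t := by
  rw [lm0, lm1, lmgf, ← lintegral_add_left (by fun_prop)]
  refine lintegral_congr fun q => ?_
  have := Y_nonneg P q
  have := one_sub_Y_nonneg P q
  rw [← ENNReal.ofReal_add (by positivity) (by positivity)]
  congr 1
  ring

lemma m1_eq_toReal (t : ℝ) : m1 P t = (lm1 P t).toReal :=
  integral_eq_lintegral_of_nonneg_ae (ae_of_all _ fun q => by
      have := Y_nonneg P q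
      positivity)
    (by fun_prop : Measurable fun q => Real.exp (t * X q) * Y P q).aestronglyMeasurable

lemma m0_eq_toReal (t : ℝ) : m0 P t = (lm0 P t).toReal :=
  integral_eq_lintegral_of_nonneg_ae (ae_of_all _ fun q => by
      have := one_sub_Y_nonneg P q
      positivity)
    (by fun_prop : Measurable fun q => Real.exp (t * X q) * (1 - Y P q)).aestronglyMeasurable

/-- Given the successful trial, the average over the choices is `agreeProb`, affine in `w`; its
exponential decays merge with `e^{tX}` and shift the arguments. The vacuous factor with `storage s *
0` gives both summands the shape of `setLIntegral_exp`. -/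
lemma lintegral_choice (t : ℝ) {s : SwapTrial} (hs : 0 ≤ storage s ∧ 0 ≤ tC' s) :
    ∫⁻ z : ℝ × Fin 2 × Bool × Bool × unitInterval,
      ENNReal.ofReal (Real.exp (t * (vMax s + tC' s + z.1))) *
        (if outcome P (endWerner P s) z.1 z.2.1 z.2.2.1 z.2.2.2.2 z.2.2.1 = z.2.1 then 1 else 0)
        ∂((abLaw P).prod choiceLaw) =
      ENNReal.ofReal (1 / 4) * (2 * (ENNReal.ofReal (Real.exp (t * vMax s) *
        Real.exp (-storage s * 0)) *
        ENNReal.ofReal (Real.exp (t * tC' s)) * lmgf id (abLaw P) t) +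
        ENNReal.ofReal (P.w0 ^ 2) *
        (ENNReal.ofReal (Real.exp (t * vMax s) * Real.exp (-storage s * P.tc⁻¹)) *
          ENNReal.ofReal (Real.exp ((t - 1 / P.tc) * tC' s)) *
          (lmgf id (abLaw P) (t - 1 / P.tda) +
            lmgf id (abLaw P) (t - 1 / P.tde - 1 / (2 * P.tda))))) := by
  have hm : Measurable fun z : ℝ × Fin 2 × Bool × Bool × unitInterval =>
      ENNReal.ofReal (Real.exp (t * (vMax s + tC' s + z.1))) *
        (if outcome P (endWerner P s) z.1 z.2.1 z.2.2.1 z.2.2.2.2 z.2.2.1 = z.2.1 then 1 else 0) :=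
    Measurable.mul (by fun_prop) (Measurable.ite (measurableSet_eq_fun
      (Measurable.outcome P measurable_const (by fun_prop) (by fun_prop) (by fun_prop)
        (by fun_prop) (by fun_prop)) (by fun_prop)) measurable_const measurable_const)
  have hm' (x : ℝ) : Measurable fun c : Fin 2 × Bool × Bool × unitInterval =>
      (if outcome P (endWerner P s) x c.1 c.2.1 c.2.2.2 c.2.1 = c.1 then 1 else 0 : ℝ≥0∞) :=
    Measurable.ite (measurableSet_eq_fun (Measurable.outcome P measurable_const measurable_const
      (by fun_prop) (by fun_prop) (by fun_prop) (by fun_prop)) (by fun_prop))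
      measurable_const measurable_const
  rw [lintegral_prod _ hm.aemeasurable]
  have key : ∀ᵐ x ∂abLaw P, ∫⁻ c : Fin 2 × Bool × Bool × unitInterval,
      ENNReal.ofReal (Real.exp (t * (vMax s + tC' s + x))) *
        (if outcome P (endWerner P s) x c.1 c.2.1 c.2.2.2 c.2.1 = c.1 then 1 else 0)
        ∂choiceLaw =
      ENNReal.ofReal (1 / 4) * (2 * (ENNReal.ofReal (Real.exp (t * vMax s) *
        Real.exp (-storage s * 0)) *
        ENNReal.ofReal (Real.exp (t * tC' s)) * ENNReal.ofReal (Real.exp (t * id x))) +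
        ENNReal.ofReal (P.w0 ^ 2) *
        (ENNReal.ofReal (Real.exp (t * vMax s) * Real.exp (-storage s * P.tc⁻¹)) *
          ENNReal.ofReal (Real.exp ((t - 1 / P.tc) * tC' s)) *
          (ENNReal.ofReal (Real.exp ((t - 1 / P.tda) * id x)) +
            ENNReal.ofReal (Real.exp ((t - 1 / P.tde - 1 / (2 * P.tda)) * id x))))) := by
    filter_upwards [ae_nonneg_seLaw P.shiftAB_nonneg] with x hx
    rw [lintegral_const_mul _ (hm' x),
      choiceLaw_agree P (endWerner_nonneg P s) (endWerner_le_one P hs) hx, agreeProb]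
    rw [← ENNReal.ofReal_ofNat 2]
    rw [← ENNReal.ofReal_add (by positivity) (by positivity)]
    -- Everything is gathered under one `ENNReal.ofReal`, so that an identity of reals remains.
    repeat rw [← ENNReal.ofReal_mul (by positivity)]
    rw [← ENNReal.ofReal_add (by positivity) (by positivity), ← ENNReal.ofReal_mul (by positivity)]
    congr 1
    rw [endWerner_eq]
    have e1 : Real.exp (t * (vMax s + tC' s + x)) =
        Real.exp (t * vMax s) * Real.exp (t * tC' s) * Real.exp (t * x) := by
      rw [← Real.exp_add, ← Real.exp_add]; congr 1; ring
    have e2 : Real.exp ((t - 1 / P.tc) * tC' s) =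
        Real.exp (t * tC' s) * Real.exp (-(1 / P.tc) * tC' s) := by
      rw [← Real.exp_add]; congr 1; ring
    have e3 : Real.exp ((t - 1 / P.tda) * x) = Real.exp (t * x) * Real.exp (-x / P.tda) := by
      rw [← Real.exp_add]; congr 1; ring
    have e4 : Real.exp ((t - 1 / P.tde - 1 / (2 * P.tda)) * x) =
        Real.exp (t * x) * Real.exp (-x / P.tde - x / (2 * P.tda)) := by
      rw [← Real.exp_add]; congr 1; ring
    simp only [id]
    rw [e1, e2, e3, e4]
    simp only [mul_zero, Real.exp_zero]
    ring
  rw [lintegral_congr_ae key, lintegral_const_mul _ (by fun_prop), lintegral_add_left (by fun_prop),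
    lintegral_const_mul _ (by fun_prop), lintegral_const_mul _ (by fun_prop),
    lintegral_const_mul _ (by fun_prop), lintegral_const_mul _ (by fun_prop),
    lintegral_add_left (by fun_prop)]
  rfl

lemma lm1_eq (t : ℝ) :
    lm1 P t = (1 - lFail P t)⁻¹ * (ENNReal.ofReal P.pSwap * (ENNReal.ofReal (1 / 4) *
      (2 * (lmgf vMax (swapTrialLaw P) t * lmgf id (swapComLaw P) t * lmgf id (abLaw P) t) +
        ENNReal.ofReal (P.w0 ^ 2) * (lI P t P.tc⁻¹ * lmgf id (swapComLaw P) (t - 1 / P.tc) *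
          (lmgf id (abLaw P) (t - 1 / P.tda) +
            lmgf id (abLaw P) (t - 1 / P.tde - 1 / (2 * P.tda))))))) := by
  have hm : Measurable fun y : SwapTrial × ℝ × Fin 2 × Bool × Bool × unitInterval =>
      ENNReal.ofReal (Real.exp (t * (vMax y.1 + tC' y.1 + y.2.1))) *
        (if outcome P (endWerner P y.1) y.2.1 y.2.2.1 y.2.2.2.1 y.2.2.2.2.2 y.2.2.2.1 = y.2.2.1
          then 1 else 0) :=
    Measurable.mul (by fun_prop) (Measurable.ite (measurableSet_eq_fun
      (Measurable.outcome P (by fun_prop) (by fun_prop) (by fun_prop) (by fun_prop)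
        (by fun_prop) (by fun_prop)) (by fun_prop)) measurable_const measurable_const)
  have h1 := lintegral_tGamma_mul P t hm
  have h2 : lm1 P t = ∫⁻ q, ENNReal.ofReal (Real.exp (t * tGamma q)) *
      (ENNReal.ofReal (Real.exp (t * (vMax (finalTrial q) + tC' (finalTrial q) + q.2.1))) *
        (if outcome P (endWerner P (finalTrial q)) q.2.1 q.2.2.1 q.2.2.2.1 q.2.2.2.2.2 q.2.2.2.1 =
          q.2.2.1 then 1 else 0)) ∂qubitLaw P := by
    refine lintegral_congr fun q => ?_
    rw [← mul_assoc, ← ofReal_exp_add, ← mul_add, ENNReal.ofReal_mul (Real.exp_pos _).le, X_eq,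
      ← add_assoc, ← add_assoc]
    congr 1
    rw [Y, apply_ite ENNReal.ofReal, ENNReal.ofReal_one, ENNReal.ofReal_zero]
    rfl
  rw [h2, h1]
  congr 1
  have h3 : ∀ᵐ s ∂(swapTrialLaw P).restrict {s | s.2.2.2 = true}, _ :=
    ae_restrict_of_ae ((ae_nonneg_swapTrial P).mono fun s hs => lintegral_choice P t hs)
  rw [lintegral_congr_ae h3, lintegral_const_mul _ (by fun_prop), lintegral_add_left (by fun_prop),
    lintegral_const_mul _ (by fun_prop), lintegral_const_mul _ (by fun_prop),
    lintegral_mul_const _ (by fun_prop), lintegral_mul_const _ (by fun_prop), setLIntegral_exp,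
    setLIntegral_exp, lI_zero]
  ring

variable (P : Params)

/-! ### Independence of the event that the bases match -/

/-- Exchange Bob's basis for the other one. -/
def flipBob : Qubit → Qubit :=
  Prod.map id (Prod.map id (Prod.map id (Prod.map id (Prod.map not id))))

lemma measurePreserving_flipBob : MeasurePreserving flipBob (qubitLaw P) (qubitLaw P) :=
  (MeasurePreserving.id _).prod ((MeasurePreserving.id _).prod ((MeasurePreserving.id _).prod
    ((MeasurePreserving.id _).prod (measurePreserving_not.prod (MeasurePreserving.id _)))))

lemma measurableSet_match : MeasurableSet {q | bobBasis q = aliceBasis q} :=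
  measurableSet_eq_fun measurable_bobBasis measurable_aliceBasis

/-- Flipping Bob's basis preserves the law and `G` but exchanges matching with non-matching, so each
event carries half of the integral. The proposition `r` covers both events at once; it is later `i ∈
S`. -/
lemma lintegral_mul_match {G : Qubit → ℝ≥0∞} (hG : Measurable G) (hflip : ∀ q, G (flipBob q) = G q)
    (r : Prop) [Decidable r] :
    ∫⁻ q, G q * (if (bobBasis q = aliceBasis q ↔ r) then 1 else 0) ∂qubitLaw P =
      2⁻¹ * ∫⁻ q, G q ∂qubitLaw P := by
  have hm (r : Prop) [Decidable r] :
      Measurable fun q => G q * (if (bobBasis q = aliceBasis q ↔ r) then 1 else 0) := by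
    refine hG.mul (Measurable.ite ?_ measurable_const measurable_const)
    exact measurableSet_match.iff (MeasurableSet.const r)
  have h1 : ∫⁻ q, G q * (if (bobBasis q = aliceBasis q ↔ r) then 1 else 0) ∂qubitLaw P =
      ∫⁻ q, G q * (if (bobBasis q = aliceBasis q ↔ ¬ r) then 1 else 0) ∂qubitLaw P := by
    rw [← (measurePreserving_flipBob P).lintegral_comp (hm r)]
    refine lintegral_congr fun q => ?_
    rw [hflip]
    congr 1
    have h2 : bobBasis (flipBob q) = !bobBasis q := rfl
    have h3 : aliceBasis (flipBob q) = aliceBasis q := rfl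
    rw [h2, h3]
    refine if_congr ?_ rfl rfl
    cases bobBasis q <;> cases aliceBasis q <;> simp
  have h2 : ∫⁻ q, G q ∂qubitLaw P =
      ∫⁻ q, G q * (if (bobBasis q = aliceBasis q ↔ r) then 1 else 0) ∂qubitLaw P +
      ∫⁻ q, G q * (if (bobBasis q = aliceBasis q ↔ ¬ r) then 1 else 0) ∂qubitLaw P := by
    rw [← lintegral_add_left (hm r)]
    refine lintegral_congr fun q => ?_
    by_cases h : bobBasis q = aliceBasis q <;> by_cases hr : r <;> simp [h, hr]
  rw [h2, ← h1, ← two_mul, ← mul_assoc, ENNReal.inv_mul_cancel two_ne_zero ENNReal.ofNat_ne_top,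
    one_mul]

/-! ### The success of an attempt -/

variable {n : ℕ}

/-- The qubits for which the bases match. -/
def matchSet (q : Fin n → Qubit) : Finset (Fin n) :=
  Finset.univ.filter fun i => bobBasis (q i) = aliceBasis (q i)

/-- The qubits for which Bob's result in his own basis is Alice's bit. -/
noncomputable def agreeSet (q : Fin n → Qubit) : Finset (Fin n) :=
  Finset.univ.filter fun i => result P (q i) (bobBasis (q i)) = aliceBit (q i)

/-- The check of the sample `T` is passed when `A` is the set of correct results. -/
def Passes (T A : Finset (Fin n)) : Prop :=
  1 ≤ T.card ∧ P.β * (T.card : ℝ) ≤ ((T ∩ A).card : ℝ)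

lemma success_iff (a : Attempt n) :
    success P a ↔ Passes P (a.2.1 (matchSet a.1)) (agreeSet P a.1) := by
  have : agreeSet P a.1 = Finset.univ.filter fun i =>
    result P (a.1 i) (bobBasis (a.1 i)) = aliceBit (a.1 i) := rfl
  rw [success, Passes, this, Finset.inter_filter, Finset.inter_univ]
  rfl

lemma measurable_matchSet : Measurable (matchSet (n := n)) := by
  refine measurable_finset_iff.2 fun i => ?_
  simp only [matchSet, Finset.mem_filter, Finset.mem_univ, true_and]
  exact measurableSet_setOfPred.1 (measurableSet_match.preimage (measurable_pi_apply i))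

lemma measurable_agreeSet : Measurable (agreeSet P (n := n)) := by
  refine measurable_finset_iff.2 fun i => ?_
  simp only [agreeSet, Finset.mem_filter, Finset.mem_univ, true_and]
  exact measurableSet_setOfPred.1 ((measurableSet_agree P measurable_bobBasis).preimage
    (measurable_pi_apply i))

lemma measurable_eval_finset :
    Measurable fun p : (Finset (Fin n) → Finset (Fin n)) × Finset (Fin n) => p.1 p.2 :=
  measurable_from_prod_countable_left fun S => measurable_pi_apply S

lemma measurableSet_passes {Ω : Type*} [MeasurableSpace Ω] {f g : Ω → Finset (Fin n)}
    (hf : Measurable f) (hg : Measurable g) : MeasurableSet {x | Passes P (f x) (g x)} :=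
  (hf.prodMk hg) (Set.to_countable
    {p : Finset (Fin n) × Finset (Fin n) | Passes P p.1 p.2}).measurableSet

lemma measurableSet_success : MeasurableSet {a : Attempt n | success P a} := by
  simp only [success_iff]
  exact measurableSet_passes P (measurable_eval_finset.comp
    ((measurable_fst.comp measurable_snd).prodMk (measurable_matchSet.comp measurable_fst))) ((measurable_agreeSet P).comp measurable_fst)

@[fun_prop]
lemma measurable_duration : Measurable (duration (n := n)) := by unfold duration; fun_prop

/-- `E (e^{tX_1 + ... + tX_k}; Y_1 + ... + Y_k ≥ β k)`, with values in `[0, ∞]`. -/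
noncomputable def lTail (t : ℝ) (k : ℕ) : ℝ≥0∞ :=
  ∑ j ∈ Finset.range (k + 1),
    k.choose j • if P.β * (k : ℝ) ≤ j then lm1 P t ^ j * lm0 P t ^ (k - j) else 0

lemma ite_mul_ite_eq_ite {a b c : Prop} {_ : Decidable a} {_ : Decidable b} {_ : Decidable c}
    (h : a ∧ b ↔ c) :
    (if a then 1 else 0) * (if b then 1 else 0) = (if c then 1 else 0 : ℝ≥0∞) := by
  by_cases ha : a <;> by_cases hb : b <;> simp [← h, ha, hb]

-- Summing over the possible sets `A ⊆ T` of correct results in the sample makes the integrand a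
-- product over the qubits. Each qubit contributes `1/2` for its basis condition, times `m₁` in `A`,
-- `m₀` in `T \ A` and `M_X` outside `T`.
open Classical in
lemma lintegral_passes (t : ℝ) {S T : Finset (Fin n)} (hT : T ⊆ S) :
    ∫⁻ q, (if matchSet q = S then 1 else 0) * (if Passes P T (agreeSet P q) then 1 else 0) *
        ENNReal.ofReal (Real.exp (t * ∑ i, X (q i))) ∂(Measure.pi fun _ : Fin n => qubitLaw P) =
      if 1 ≤ T.card then 2⁻¹ ^ n * (lmgf X (qubitLaw P) t ^ (n - T.card) * lTail P t T.card)
        else 0 := by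
  split_ifs with hT1
  swap
  · simp [Passes, hT1]
  let wt (A : Finset (Fin n)) (i : Fin n) (x : Qubit) : ℝ≥0∞ :=
    (ENNReal.ofReal (Real.exp (t * X x)) * if (i ∈ T → (Y P x = 1 ↔ i ∈ A)) then 1 else 0) *
      if (bobBasis x = aliceBasis x ↔ i ∈ S) then 1 else 0
  have hYset : MeasurableSet {x | Y P x = 1} := measurableSet_eq_fun (by fun_prop) measurable_const
  have hm0 (A : Finset (Fin n)) (i : Fin n) : Measurable fun x =>
      ENNReal.ofReal (Real.exp (t * X x)) * if (i ∈ T → (Y P x = 1 ↔ i ∈ A)) then (1 : ℝ≥0∞) else 0 :=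
    Measurable.mul (by fun_prop) (Measurable.ite ((MeasurableSet.const (i ∈ T)).imp
      (hYset.iff (MeasurableSet.const _))) measurable_const measurable_const)
  have hm (A : Finset (Fin n)) (i : Fin n) : Measurable (wt A i) :=
    (hm0 A i).mul (Measurable.ite (measurableSet_match.iff (MeasurableSet.const _))
      measurable_const measurable_const)
  have hpt (q : Fin n → Qubit) :
      (if matchSet q = S then 1 else 0) * (if Passes P T (agreeSet P q) then 1 else 0) *
        ENNReal.ofReal (Real.exp (t * ∑ i, X (q i))) =
      ∑ A ∈ T.powerset, if P.β * (T.card : ℝ) ≤ A.card then ∏ i, wt A i (q i) else 0 := by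
    have hprod (A : Finset (Fin n)) (hA : A ∈ T.powerset) : ∏ i, wt A i (q i) =
        ENNReal.ofReal (Real.exp (t * ∑ i, X (q i))) *
          (if A = T ∩ agreeSet P q ∧ matchSet q = S then 1 else 0) := by
      rw [Finset.mem_powerset] at hA
      simp only [wt, Finset.prod_mul_distrib, Finset.prod_boole]
      rw [Finset.mul_sum, Real.exp_sum, ENNReal.ofReal_prod_of_nonneg
        fun _ _ => (Real.exp_pos _).le, mul_assoc]
      congr 1
      refine ite_mul_ite_eq_ite ?_
      have hS : (∀ i ∈ Finset.univ, (bobBasis (q i) = aliceBasis (q i) ↔ i ∈ S)) ↔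
          matchSet q = S := by
        simp [matchSet, Finset.ext_iff]
      rw [hS]
      refine and_congr_left fun hq => ?_
      -- Sampled qubits have matching bases since `T ⊆ S`; only there is Bob's actual result the one
      -- recorded by `Y`.
      have hY (i : Fin n) (hi : i ∈ T) : Y P (q i) = 1 ↔ i ∈ agreeSet P q := by
        have hi' : i ∈ matchSet q := hq ▸ hT hi
        simp only [matchSet, Finset.mem_filter, Finset.mem_univ, true_and] at hi'
        simp [agreeSet, Y, hi']
      constructor
      · intro h
        ext i
        rw [Finset.mem_inter]
        constructor
        · exact fun hi => ⟨hA hi, (hY i (hA hi)).1 ((h i (Finset.mem_univ i) (hA hi)).2 hi)⟩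
        · exact fun hi => (h i (Finset.mem_univ i) hi.1).1 ((hY i hi.1).2 hi.2)
      · rintro rfl i - hi
        rw [hY i hi, Finset.mem_inter]
        exact ⟨fun h => ⟨hi, h⟩, fun h => h.2⟩
    rw [Finset.sum_eq_single_of_mem (T ∩ agreeSet P q)
      (Finset.mem_powerset.2 Finset.inter_subset_left)]
    · rw [hprod _ (Finset.mem_powerset.2 Finset.inter_subset_left)]
      by_cases h1 : matchSet q = S <;>
        by_cases h2 : P.β * (T.card : ℝ) ≤ ((T ∩ agreeSet P q).card : ℝ) <;>
        simp [Passes, h1, h2, hT1]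
    · intro A hA hne
      rw [hprod A hA, if_neg (c := A = T ∩ agreeSet P q ∧ _) (fun h => hne h.1), mul_zero,
        ite_self]
  have hint (A : Finset (Fin n)) (hA : A ∈ T.powerset) :
      ∫⁻ q, ∏ i, wt A i (q i) ∂(Measure.pi fun _ : Fin n => qubitLaw P) =
        2⁻¹ ^ n * (lmgf X (qubitLaw P) t ^ (n - T.card) *
          (lm1 P t ^ A.card * lm0 P t ^ (T.card - A.card))) := by
    rw [Finset.mem_powerset] at hA
    rw [lintegral_pi_prod _ _ (hm A)]
    have hfac (i : Fin n) : ∫⁻ x, wt A i x ∂qubitLaw P =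
        2⁻¹ * if i ∈ T then (if i ∈ A then lm1 P t else lm0 P t) else lmgf X (qubitLaw P) t := by
      simp only [wt]
      -- Neither `X` nor `Y` reads Bob's basis, so invariance under the flip is definitional.
      rw [lintegral_mul_match P (hm0 A i) (fun q => rfl)]
      congr 1
      by_cases hi : i ∈ T
      · by_cases hiA : i ∈ A
        · rw [if_pos hi, if_pos hiA]
          refine lintegral_congr fun x => ?_
          rcases Y_eq_zero_or_one P x with h | h <;> simp [hi, hiA, h]
        · rw [if_pos hi, if_neg hiA]
          refine lintegral_congr fun x => ?_
          rcases Y_eq_zero_or_one P x with h | h <;> simp [hi, hiA, h]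
      · simp [hi, lmgf]
    simp only [hfac]
    rw [Finset.prod_mul_distrib, Finset.prod_const, Finset.card_univ, Fintype.card_fin]
    congr 1
    rw [Finset.prod_ite, Finset.prod_const, mul_comm]
    congr 1
    · congr 1
      rw [← Finset.compl_filter, Finset.card_compl, Fintype.card_fin, Finset.filter_univ_mem]
    · rw [Finset.filter_univ_mem, Finset.prod_ite, Finset.prod_const, Finset.prod_const]
      have h1 : T.filter (· ∈ A) = A := by
        rw [Finset.filter_mem_eq_inter, Finset.inter_eq_right.2 hA]
      have h2 : T.filter (fun i => ¬ i ∈ A) = T \ A := by rw [Finset.filter_notMem_eq_sdiff]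
      rw [h1, h2, Finset.card_sdiff_of_subset hA]
  simp only [hpt]
  rw [lintegral_finsetSum]
  swap
  · intro A _
    split_ifs
    · exact Finset.measurable_prod _ fun i _ => (hm A i).comp (measurable_pi_apply i)
    · exact measurable_const
  rw [lTail, Finset.mul_sum, Finset.mul_sum]
  -- The terms depend on `A` only through its size; grouping by size produces the binomial
  -- coefficients of `lTail`.
  have := Finset.sum_powerset_apply_card (x := T) (fun j => 2⁻¹ ^ n *
    (lmgf X (qubitLaw P) t ^ (n - T.card) * if P.β * (T.card : ℝ) ≤ j then lm1 P t ^ j * lm0 P t ^ (T.card - j) else 0))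
  refine (Finset.sum_congr rfl fun A hA => ?_).trans
    (this.trans (Finset.sum_congr rfl fun j _ => ?_))
  · split_ifs
    · exact hint A hA
    · simp
  · simp only [nsmul_eq_mul]
    ring

/-- `E (e^{t D}; success) / M_{K_C}(t)`, where `D` is the duration of an attempt. -/
noncomputable def lSucc (n : ℕ) (t : ℝ) : ℝ≥0∞ :=
  ∑ j ∈ Finset.range (n + 1), n.choose j • if 1 ≤ ⌈P.α * (j : ℝ)⌉₊ then
    2⁻¹ ^ n * (lmgf X (qubitLaw P) t ^ (n - ⌈P.α * (j : ℝ)⌉₊) * lTail P t ⌈P.α * (j : ℝ)⌉₊) else 0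

lemma ceil_mul_le (j : ℕ) : ⌈P.α * (j : ℝ)⌉₊ ≤ j :=
  Nat.ceil_le.2 (mul_le_of_le_one_left (Nat.cast_nonneg _) P.α_le_one)

-- By `lintegral_passes` all samples of the prescribed size contribute equally, so their uniform
-- average disappears. Grouping the matching sets `S` by size gives the coefficients `n.choose j`.
open Classical in
lemma setLIntegral_success (t : ℝ) :
    ∫⁻ a in {a : Attempt n | success P a}, ENNReal.ofReal (Real.exp (t * duration a))
      ∂attemptLaw P n = lmgf id (abLaw P) t * lSucc P n t := by
  have hms (S : Finset (Fin n)) : MeasurableSet {q : Fin n → Qubit | matchSet q = S} :=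
    measurable_matchSet (measurableSet_singleton S)
  have hmp (T : Finset (Fin n)) : MeasurableSet {q : Fin n → Qubit | Passes P T (agreeSet P q)} :=
    measurableSet_passes P measurable_const (measurable_agreeSet P)
  have hE : Measurable fun q : Fin n → Qubit => ENNReal.ofReal (Real.exp (t * ∑ i, X (q i))) := by
    fun_prop
  have hmf : Measurable fun y : (Fin n → Qubit) × (Finset (Fin n) → Finset (Fin n)) =>
      (if Passes P (y.2 (matchSet y.1)) (agreeSet P y.1) then 1 else 0 : ℝ≥0∞) :=
    Measurable.ite (measurableSet_passes P (measurable_eval_finset.comp (measurable_snd.prodMk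
      (measurable_matchSet.comp measurable_fst))) ((measurable_agreeSet P).comp measurable_fst))
      measurable_const measurable_const
  have hstep : ∫⁻ a in {a : Attempt n | success P a}, ENNReal.ofReal (Real.exp (t * duration a))
      ∂attemptLaw P n = ∫⁻ q, (ENNReal.ofReal (Real.exp (t * ∑ i, X (q i))) *
        ∫⁻ f : Finset (Fin n) → Finset (Fin n),
          (if Passes P (f (matchSet q)) (agreeSet P q) then 1 else 0)
          ∂(Measure.pi fun S => sampleLaw P n S)) * lmgf id (abLaw P) t
        ∂(Measure.pi fun _ : Fin n => qubitLaw P) := by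
    rw [← lintegral_indicator (measurableSet_success P), attemptLaw, lintegral_prod]
    swap
    · exact (Measurable.indicator (by fun_prop) (measurableSet_success P)).aemeasurable
    refine lintegral_congr fun q => ?_
    have hmq : Measurable fun f : Finset (Fin n) → Finset (Fin n) =>
        (if Passes P (f (matchSet q)) (agreeSet P q) then 1 else 0 : ℝ≥0∞) :=
      hmf.comp measurable_prodMk_left
    rw [← lintegral_const_mul _ hmq, lmgf, ← lintegral_prod_mul]
    · refine lintegral_congr fun z => ?_
      simp only [Set.indicator, Set.mem_ofPred_eq, success_iff, duration]
      split_ifs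
      · rw [mul_one, ← ofReal_exp_add, ← mul_add]; rfl
      · simp
    · exact (hmq.const_mul _).aemeasurable
    · fun_prop
  have hsample (q : Fin n → Qubit) :
      ∫⁻ f : Finset (Fin n) → Finset (Fin n),
          (if Passes P (f (matchSet q)) (agreeSet P q) then 1 else 0)
          ∂(Measure.pi fun S => sampleLaw P n S) =
      ∑ S, ((Finset.powersetCard ⌈P.α * (S.card : ℝ)⌉₊ S).card : ℝ≥0∞)⁻¹ *
        ∑ T ∈ Finset.powersetCard ⌈P.α * (S.card : ℝ)⌉₊ S,
          (if matchSet q = S then 1 else 0) * if Passes P T (agreeSet P q) then 1 else 0 := by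
    -- The sum over all `S` has the single nonzero term `S = matchSet q`; it makes the random set a
    -- fixed one before integrating over the qubits.
    rw [Finset.sum_eq_single_of_mem (matchSet q) (Finset.mem_univ _)]
    · simp only [if_true, one_mul]
      rw [← lintegral_uniformOn_finset]
      exact (measurePreserving_eval (fun S => sampleLaw P n S) (matchSet q)).lintegral_comp
        (f := fun T => if Passes P T (agreeSet P q) then (1 : ℝ≥0∞) else 0)
        (Measurable.ite (measurableSet_passes P measurable_id measurable_const) measurable_const
          measurable_const)
    · intro S _ hS
      simp [hS.symm]
  have hterm (S T : Finset (Fin n)) (hT : T ∈ Finset.powersetCard ⌈P.α * (S.card : ℝ)⌉₊ S)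
      (c : ℝ≥0∞) : ∫⁻ q, ENNReal.ofReal (Real.exp (t * ∑ i, X (q i))) * (c *
        ((if matchSet q = S then 1 else 0) * if Passes P T (agreeSet P q) then 1 else 0))
        ∂(Measure.pi fun _ : Fin n => qubitLaw P) =
      c * if 1 ≤ ⌈P.α * (S.card : ℝ)⌉₊ then 2⁻¹ ^ n * (lmgf X (qubitLaw P) t ^
        (n - ⌈P.α * (S.card : ℝ)⌉₊) * lTail P t ⌈P.α * (S.card : ℝ)⌉₊) else 0 := by
    rw [Finset.mem_powersetCard] at hT
    have h := lintegral_passes P t hT.1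
    rw [hT.2] at h
    rw [← h, ← lintegral_const_mul]
    · refine lintegral_congr fun q => ?_
      ring
    · exact ((Measurable.ite (hms S) measurable_const measurable_const).mul
        (Measurable.ite (hmp T) measurable_const measurable_const)).mul hE
  have hinner : Measurable fun q : Fin n → Qubit =>
      ENNReal.ofReal (Real.exp (t * ∑ i, X (q i))) *
        ∫⁻ f : Finset (Fin n) → Finset (Fin n),
          (if Passes P (f (matchSet q)) (agreeSet P q) then 1 else 0)
          ∂(Measure.pi fun S => sampleLaw P n S) :=
    hE.mul hmf.lintegral_prod_right'
  rw [hstep, lintegral_mul_const _ hinner, mul_comm]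
  congr 1
  have hexpand (q : Fin n → Qubit) : ENNReal.ofReal (Real.exp (t * ∑ i, X (q i))) *
        ∫⁻ f : Finset (Fin n) → Finset (Fin n),
          (if Passes P (f (matchSet q)) (agreeSet P q) then 1 else 0)
          ∂(Measure.pi fun S => sampleLaw P n S) =
      ∑ S, ∑ T ∈ Finset.powersetCard ⌈P.α * (S.card : ℝ)⌉₊ S,
        ENNReal.ofReal (Real.exp (t * ∑ i, X (q i))) *
          (((Finset.powersetCard ⌈P.α * (S.card : ℝ)⌉₊ S).card : ℝ≥0∞)⁻¹ *
          ((if matchSet q = S then 1 else 0) * if Passes P T (agreeSet P q) then 1 else 0)) := by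
    rw [hsample, Finset.mul_sum]
    refine Finset.sum_congr rfl fun S _ => ?_
    rw [Finset.mul_sum (Finset.powersetCard _ _), Finset.mul_sum (Finset.powersetCard _ _)]
  rw [lintegral_congr hexpand]
  have hmt (S T : Finset (Fin n)) (c : ℝ≥0∞) : Measurable fun q : Fin n → Qubit =>
      ENNReal.ofReal (Real.exp (t * ∑ i, X (q i))) * (c *
        ((if matchSet q = S then 1 else 0) * if Passes P T (agreeSet P q) then 1 else 0)) :=
    hE.mul (((Measurable.ite (hms S) measurable_const measurable_const).mul
        (Measurable.ite (hmp T) measurable_const measurable_const)).const_mul c)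
  rw [lintegral_finsetSum _ fun S _ => Finset.measurable_sum _ fun T _ => hmt S T _]
  have hcard := Finset.sum_powerset_apply_card (x := (Finset.univ : Finset (Fin n)))
    (fun j => if 1 ≤ ⌈P.α * (j : ℝ)⌉₊ then 2⁻¹ ^ n * (lmgf X (qubitLaw P) t ^
        (n - ⌈P.α * (j : ℝ)⌉₊) * lTail P t ⌈P.α * (j : ℝ)⌉₊) else 0)
  rw [Finset.card_univ, Fintype.card_fin, Finset.powerset_univ] at hcard
  rw [lSucc, ← hcard]
  refine Finset.sum_congr rfl fun S _ => ?_
  rw [lintegral_finsetSum _ fun T _ => hmt S T _, Finset.sum_congr rfl fun T hT => hterm S T hT _,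
    Finset.sum_const, nsmul_eq_mul, ← mul_assoc, ENNReal.mul_inv_cancel, one_mul]
  · rw [Nat.cast_ne_zero, Finset.card_ne_zero, Finset.powersetCard_nonempty]
    exact ceil_mul_le P _
  · exact ENNReal.natCast_ne_top _

/-! ### Binomial tails -/

section BinomTail

variable {R : Type*} [CommRing R]

/-- The tail `∑_{j ≤ i ≤ l} C(l, i) y ^ i x ^ (l - i)` of the binomial expansion
of `(x + y) ^ l`. -/
def binomTail (x y : R) (l j : ℕ) : R :=
  ∑ i ∈ Finset.range (l + 1), if j ≤ i then (l.choose i : R) * (y ^ i * x ^ (l - i)) else 0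

lemma binomTail_zero (x y : R) (l : ℕ) : binomTail x y l 0 = (x + y) ^ l := by
  rw [add_comm, add_pow, binomTail]
  refine Finset.sum_congr rfl fun i _ => ?_
  rw [if_pos (Nat.zero_le _)]
  ring

lemma binomTail_eq_add (x y : R) {l j : ℕ} (h : j ≤ l) :
    binomTail x y l j = (l.choose j : R) * (y ^ j * x ^ (l - j)) + binomTail x y l (j + 1) := by
  have : (l.choose j : R) * (y ^ j * x ^ (l - j)) = ∑ i ∈ Finset.range (l + 1),
      if j = i then (l.choose i : R) * (y ^ i * x ^ (l - i)) else 0 := by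
    rw [Finset.sum_ite_eq, if_pos (Finset.mem_range.2 (by omega))]
  rw [this, binomTail, binomTail, ← Finset.sum_add_distrib]
  refine Finset.sum_congr rfl fun i _ => ?_
  rcases lt_trichotomy i j with h | h | h
  · rw [if_neg (by omega), if_neg (by omega), if_neg (by omega), add_zero]
  · rw [if_pos (by omega), if_pos (by omega), if_neg (by omega), add_zero]
  · rw [if_pos (by omega), if_neg (by omega), if_pos (by omega), zero_add]

/-- Condition on the last of `l + 1` trials: either `j + 1` successes occurred before it and it is
arbitrary, or exactly `j` did and it succeeds. -/
lemma binomTail_succ_succ (x y : R) {l j : ℕ} (h : j ≤ l) :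
    binomTail x y (l + 1) (j + 1) = (x + y) * binomTail x y l (j + 1) +
      y * ((l.choose j : R) * (y ^ j * x ^ (l - j))) := by
  have h1 : binomTail x y (l + 1) (j + 1) = y * binomTail x y l j +
      ∑ i ∈ Finset.range (l + 1),
        if j ≤ i then (l.choose (i + 1) : R) * (y ^ (i + 1) * x ^ (l - i)) else 0 := by
    rw [binomTail, Finset.sum_range_succ', if_neg (by omega), add_zero, binomTail, Finset.mul_sum,
      ← Finset.sum_add_distrib]
    refine Finset.sum_congr rfl fun i _ => ?_
    simp only [Nat.add_le_add_iff_right]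
    split_ifs
    · rw [Nat.choose_succ_succ', Nat.add_sub_add_right]
      push_cast
      ring
    · simp
  have h2 : ∑ i ∈ Finset.range (l + 1),
        (if j ≤ i then (l.choose (i + 1) : R) * (y ^ (i + 1) * x ^ (l - i)) else 0) =
      x * binomTail x y l (j + 1) := by
    rw [Finset.sum_range_succ, Nat.choose_succ_self, Nat.cast_zero, zero_mul, ite_self, add_zero,
      binomTail, Finset.sum_range_succ' _ l, if_neg (show ¬ j + 1 ≤ 0 by omega), add_zero,
      Finset.mul_sum]
    refine Finset.sum_congr rfl fun i hi => ?_
    rw [Finset.mem_range] at hi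
    simp only [Nat.add_le_add_iff_right]
    split_ifs
    · have : l - i = l - (i + 1) + 1 := by omega
      rw [this]
      ring
    · simp
  rw [h1, h2, binomTail_eq_add x y h]
  ring

/-- Decomposition according to the position of the `(j + 1)`-st success. -/
lemma binomTail_succ_eq_sum (x y : R) {l j : ℕ} (h : j ≤ l) :
    binomTail x y l (j + 1) = y * ∑ k ∈ Finset.Ico j l,
      (x + y) ^ (l - 1 - k) * (k.choose j : R) * x ^ (k - j) * y ^ j := by
  induction l, h using Nat.le_induction with
  | base =>
    rw [Finset.Ico_self, Finset.sum_empty, mul_zero, binomTail]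
    refine Finset.sum_eq_zero fun i hi => ?_
    rw [Finset.mem_range] at hi
    rw [if_neg (by omega)]
  | succ l h ih =>
    rw [binomTail_succ_succ x y h, ih, Finset.sum_Ico_succ_top h, mul_add, ← mul_assoc,
      mul_comm (x + y) y, mul_assoc, Finset.mul_sum]
    congr 1
    · congr 1
      refine Finset.sum_congr rfl fun k hk => ?_
      rw [Finset.mem_Ico] at hk
      have : l + 1 - 1 - k = l - 1 - k + 1 := by omega
      rw [this]
      ring
    · have : l + 1 - 1 - l = 0 := by omega
      rw [this]
      ring

end BinomTail

variable (P : Params)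

/-- In the general case the tail is its term of index `j` plus the decomposition by the position of
the `(j + 1)`-st success. Splitting off the last position, `k = l - 1`, yields the second term of
the sum over `range 2`. The other cases are the same tail with few or no terms. -/
lemma M1_eq_binomTail (t : ℝ) {l j : ℕ} (hj : j ≤ l) :
    M1 P t l j = binomTail (m0 P t) (m1 P t) l j := by
  rw [M1]
  split_ifs with h1 h2 h3
  · rw [h1, binomTail_zero]
  · subst h2
    rw [binomTail_eq_add _ _ le_rfl, binomTail_succ_eq_sum _ _ le_rfl]
    simp
  · subst h3
    rw [binomTail_eq_add _ _ hj, binomTail_succ_eq_sum _ _ hj]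
    simp
    ring
  · obtain ⟨l, rfl⟩ : ∃ k, l = k + 2 := ⟨l - 2, by omega⟩
    rw [binomTail_eq_add _ _ hj, binomTail_succ_eq_sum _ _ hj,
      Finset.sum_Ico_succ_top (by omega : j ≤ l + 1), Finset.sum_range_succ, Finset.sum_range_one,
      Nat.add_sub_cancel, ← Finset.Ico_add_one_right_eq_Icc]
    have : l + 2 - 1 - (l + 1) = 0 := by omega
    rw [this]
    have : l + 2 - 1 = l + 1 := by omega
    rw [this]
    simp only [Nat.sub_zero, pow_zero]
    ring

/-! ### The closed form of `D` -/

lemma ceil_mul_eq_iff {j k : ℕ} (hk : 1 ≤ k) :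
    ⌈P.α * (j : ℝ)⌉₊ = k ↔ j ∈ Finset.Ioc ⌊((k : ℝ) - 1) / P.α⌋₊ ⌊(k : ℝ) / P.α⌋₊ := by
  have hα := P.α_pos
  have hk' : (1 : ℝ) ≤ k := by exact_mod_cast hk
  rw [Nat.ceil_eq_iff (by omega), Finset.mem_Ioc,
    Nat.floor_lt (div_nonneg (by linarith) hα.le),
    Nat.le_floor_iff (by positivity), div_lt_iff₀ hα, le_div_iff₀ hα, Nat.cast_sub hk,
    Nat.cast_one, mul_comm]

/-- The closed form groups the numbers `j` of matching bases by the sample size `k = ⌈α j⌉`; the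
interval `(k - 1) / α < j ≤ k / α` is the fibre over `k`. -/
lemma D_eq_sum (n : ℕ) (t : ℝ) :
    D P n t = ∑ j ∈ Finset.range (n + 1), (n.choose j : ℝ) * if 1 ≤ ⌈P.α * (j : ℝ)⌉₊ then
      (2⁻¹ ^ n * (MX P t ^ (n - ⌈P.α * (j : ℝ)⌉₊) *
        binomTail (m0 P t) (m1 P t) ⌈P.α * (j : ℝ)⌉₊ ⌈P.β * (⌈P.α * (j : ℝ)⌉₊ : ℝ)⌉₊)) else 0 := by
  set G : ℕ → ℝ := fun k => 2⁻¹ ^ n * (MX P t ^ (n - k) *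
        binomTail (m0 P t) (m1 P t) k ⌈P.β * (k : ℝ)⌉₊) with hG
  have h1 : ∑ j ∈ Finset.range (n + 1), (n.choose j : ℝ) * (if 1 ≤ ⌈P.α * (j : ℝ)⌉₊ then
      G ⌈P.α * (j : ℝ)⌉₊ else 0) = ∑ j ∈ (Finset.range (n + 1)).filter
        (fun j : ℕ => 1 ≤ ⌈P.α * (j : ℝ)⌉₊), (n.choose j : ℝ) * G ⌈P.α * (j : ℝ)⌉₊ := by
    rw [Finset.sum_filter]
    refine Finset.sum_congr rfl fun j _ => ?_
    split_ifs <;> simp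
  have hmaps : ∀ j ∈ (Finset.range (n + 1)).filter (fun j : ℕ => 1 ≤ ⌈P.α * (j : ℝ)⌉₊),
      ⌈P.α * (j : ℝ)⌉₊ ∈ Finset.Icc 1 ⌈P.α * (n : ℝ)⌉₊ := by
    intro j hj
    rw [Finset.mem_filter, Finset.mem_range] at hj
    refine Finset.mem_Icc.2 ⟨hj.2, Nat.ceil_mono ?_⟩
    have : (j : ℝ) ≤ n := by exact_mod_cast Nat.lt_succ_iff.1 hj.1
    exact mul_le_mul_of_nonneg_left this P.α_pos.le
  refine Eq.trans ?_ h1.symm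
  rw [← Finset.sum_fiberwise_of_maps_to hmaps, D]
  refine Finset.sum_congr rfl fun k hk => ?_
  rw [Finset.mem_Icc] at hk
  have hβ : ⌈P.β * (k : ℝ)⌉₊ ≤ k :=
    Nat.ceil_le.2 (mul_le_of_le_one_left (Nat.cast_nonneg _) P.β_le_one)
  have h2 : ∑ j ∈ ((Finset.range (n + 1)).filter (fun j : ℕ => 1 ≤ ⌈P.α * (j : ℝ)⌉₊)).filter
      (fun j : ℕ => ⌈P.α * (j : ℝ)⌉₊ = k), (n.choose j : ℝ) * G ⌈P.α * (j : ℝ)⌉₊ =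
      (∑ j ∈ ((Finset.range (n + 1)).filter (fun j : ℕ => 1 ≤ ⌈P.α * (j : ℝ)⌉₊)).filter
      (fun j : ℕ => ⌈P.α * (j : ℝ)⌉₊ = k), (n.choose j : ℝ)) * G k := by
    rw [Finset.sum_mul]
    refine Finset.sum_congr rfl fun j hj => ?_
    rw [(Finset.mem_filter.1 hj).2]
  have h3 : ∑ j ∈ ((Finset.range (n + 1)).filter (fun j : ℕ => 1 ≤ ⌈P.α * (j : ℝ)⌉₊)).filter
      (fun j : ℕ => ⌈P.α * (j : ℝ)⌉₊ = k), (n.choose j : ℝ) =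
      ∑ j ∈ Finset.Ioc ⌊((k : ℝ) - 1) / P.α⌋₊ ⌊(k : ℝ) / P.α⌋₊, (n.choose j : ℝ) := by
    -- The interval may contain indices `j > n`, for which the binomial coefficient vanishes.
    refine Finset.sum_subset (fun j hj => (ceil_mul_eq_iff P hk.1).1 (Finset.mem_filter.1 hj).2) ?_
    intro j hj hj'
    have hjk := (ceil_mul_eq_iff P hk.1).2 hj
    rw [Nat.choose_eq_zero_of_lt, Nat.cast_zero]
    by_contra! hle
    refine hj' (Finset.mem_filter.2 ⟨Finset.mem_filter.2 ⟨Finset.mem_range.2 (by omega), ?_⟩, hjk⟩)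
    omega
  rw [h2, h3, hG, M1_eq_binomTail P t hβ]
  simp only [one_div, inv_pow]
  ring

/-- The real threshold `β * k ≤ j` is the integer threshold `⌈β * k⌉ ≤ j`. -/
lemma toReal_lTail {t : ℝ} (h0 : lm0 P t ≠ ⊤) (h1 : lm1 P t ≠ ⊤) (k : ℕ) :
    (lTail P t k).toReal = binomTail (m0 P t) (m1 P t) k ⌈P.β * (k : ℝ)⌉₊ := by
  rw [lTail, ENNReal.toReal_sum, binomTail]
  · refine Finset.sum_congr rfl fun j _ => ?_
    rw [nsmul_eq_mul, ENNReal.toReal_mul, ENNReal.toReal_natCast, m0_eq_toReal, m1_eq_toReal]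
    simp only [Nat.ceil_le]
    split_ifs <;> simp
  · intro j _
    rw [nsmul_eq_mul]
    split_ifs
    · finiteness
    · simp

lemma lTail_ne_top {t : ℝ} (h0 : lm0 P t ≠ ⊤) (h1 : lm1 P t ≠ ⊤) (k : ℕ) : lTail P t k ≠ ⊤ := by
  rw [lTail]
  refine ENNReal.sum_ne_top.2 fun j _ => ?_
  rw [nsmul_eq_mul]
  split_ifs
  · finiteness
  · simp

variable {P} in
lemma lm1_ne_top {t : ℝ} (hX : lmgf X (qubitLaw P) t ≠ ⊤) : lm1 P t ≠ ⊤ :=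
  ne_top_of_le_ne_top hX (by rw [← lm0_add_lm1]; exact le_add_self)

variable {P} in
lemma lm0_ne_top {t : ℝ} (hX : lmgf X (qubitLaw P) t ≠ ⊤) : lm0 P t ≠ ⊤ :=
  ne_top_of_le_ne_top hX (by rw [← lm0_add_lm1]; exact le_self_add)

lemma lSucc_term_ne_top {t : ℝ} (hX : lmgf X (qubitLaw P) t ≠ ⊤) (n j : ℕ) :
    (n.choose j • if 1 ≤ ⌈P.α * (j : ℝ)⌉₊ then
    2⁻¹ ^ n * (lmgf X (qubitLaw P) t ^ (n - ⌈P.α * (j : ℝ)⌉₊) * lTail P t ⌈P.α * (j : ℝ)⌉₊) else 0)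
      ≠ ⊤ := by
  have := lTail_ne_top P (lm0_ne_top hX) (lm1_ne_top hX) ⌈P.α * (j : ℝ)⌉₊
  rw [nsmul_eq_mul]
  split_ifs
  · finiteness
  · simp

lemma toReal_lSucc {t : ℝ} (hX : lmgf X (qubitLaw P) t ≠ ⊤) (n : ℕ) :
    (lSucc P n t).toReal = D P n t := by
  rw [lSucc, ENNReal.toReal_sum fun j _ => lSucc_term_ne_top P hX n j, D_eq_sum]
  refine Finset.sum_congr rfl fun j _ => ?_
  rw [nsmul_eq_mul, ENNReal.toReal_mul, ENNReal.toReal_natCast,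
    ← toReal_lTail P (lm0_ne_top hX) (lm1_ne_top hX), MX, mgf_eq_toReal_lmgf measurable_X]
  split_ifs <;> simp

lemma lSucc_ne_top {t : ℝ} (hX : lmgf X (qubitLaw P) t ≠ ⊤) (n : ℕ) : lSucc P n t ≠ ⊤ := by
  rw [lSucc]
  exact ENNReal.sum_ne_top.2 fun j _ => lSucc_term_ne_top P hX n j

/-- The first summand of `lm1_eq` is exactly half of `M_X`, and the entanglement term is
nonnegative. Hence `m₁` is nonzero, and infinite whenever `M_X` is. -/
lemma half_lmgf_X_le_lm1 (t : ℝ) : 2⁻¹ * lmgf X (qubitLaw P) t ≤ lm1 P t := by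
  have h : ENNReal.ofReal (1 / 4) * 2 = 2⁻¹ := by
    rw [← ENNReal.ofReal_ofNat 2, ← ENNReal.ofReal_mul (by norm_num),
      ← ENNReal.ofReal_inv_of_pos (by norm_num)]
    norm_num
  rw [lmgf_X, lm1_eq, mul_add, ← mul_assoc (ENNReal.ofReal (1 / 4)), h, mul_left_comm,
    mul_left_comm (2⁻¹ : ℝ≥0∞)]
  gcongr
  exact le_self_add

lemma lm1_ne_zero (t : ℝ) : lm1 P t ≠ 0 := by
  have h := half_lmgf_X_le_lm1 P t
  intro h0
  rw [h0, nonpos_iff_eq_zero, mul_eq_zero] at h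
  exact h.elim (by simp) (lmgf_ne_zero measurable_X t)

/-- Keeps only the case where all bases match and every sampled result is correct, which passes the
check because `β ≤ 1`. -/
lemma le_lSucc {n : ℕ} (hn : 1 ≤ n) (t : ℝ) :
    2⁻¹ ^ n * (lmgf X (qubitLaw P) t ^ (n - ⌈P.α * (n : ℝ)⌉₊) * lm1 P t ^ ⌈P.α * (n : ℝ)⌉₊) ≤
      lSucc P n t := by
  have hc : 1 ≤ ⌈P.α * (n : ℝ)⌉₊ := by
    rw [Nat.one_le_ceil_iff]
    have : (0 : ℝ) < n := by exact_mod_cast hn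
    exact mul_pos P.α_pos this
  refine le_trans ?_ (Finset.single_le_sum (fun _ _ => zero_le) (Finset.self_mem_range_succ n))
  rw [Nat.choose_self, one_smul, if_pos hc]
  gcongr
  refine le_trans ?_ (Finset.single_le_sum (fun _ _ => zero_le) (Finset.self_mem_range_succ _))
  rw [Nat.choose_self, one_smul, if_pos (mul_le_of_le_one_left (Nat.cast_nonneg _) P.β_le_one),
    Nat.sub_self, pow_zero, mul_one]

lemma lSucc_ne_zero {n : ℕ} (hn : 1 ≤ n) (t : ℝ) : lSucc P n t ≠ 0 := by
  intro h
  have h1 := le_lSucc P hn t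
  rw [h, nonpos_iff_eq_zero] at h1
  have h2 := lmgf_ne_zero (μ := qubitLaw P) measurable_X t
  have h3 := lm1_ne_zero P t
  simp [h2, h3] at h1

/-- If `M_X = ⊤` then `m₁ = ⊤`, and it enters the lower bound `le_lSucc` with exponent `⌈α n⌉ ≥ 1`,
next to nonzero factors. -/
lemma lmgf_X_ne_top_of_lSucc {n : ℕ} (hn : 1 ≤ n) {t : ℝ} (h : lSucc P n t ≠ ⊤) :
    lmgf X (qubitLaw P) t ≠ ⊤ := by
  intro hX
  have hm : lm1 P t = ⊤ := by
    rw [← top_le_iff]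
    refine le_trans ?_ (half_lmgf_X_le_lm1 P t)
    rw [hX, ENNReal.mul_top (by simp)]
  have hc : ⌈P.α * (n : ℝ)⌉₊ ≠ 0 := by
    rw [← Nat.one_le_iff_ne_zero, Nat.one_le_ceil_iff]
    have : (0 : ℝ) < n := by exact_mod_cast hn
    exact mul_pos P.α_pos this
  have h1 := ne_top_of_le_ne_top h (le_lSucc P hn t)
  rw [hm, ENNReal.top_pow hc, ENNReal.mul_top, ENNReal.mul_top] at h1
  · exact h1 rfl
  · simp
  · exact pow_ne_zero _ (lmgf_ne_zero measurable_X t)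

/-! ### The completion time -/

lemma lmgf_duration (n : ℕ) (t : ℝ) :
    lmgf duration (attemptLaw P n) t = lmgf id (abLaw P) t * lmgf X (qubitLaw P) t ^ n := by
  have h1 : lmgf duration (attemptLaw P n) t = ∫⁻ a : Attempt n,
      (∏ i, ENNReal.ofReal (Real.exp (t * X (a.1 i)))) * ENNReal.ofReal (Real.exp (t * a.2.2))
        ∂attemptLaw P n := by
    refine lintegral_congr fun a => ?_
    rw [duration, mul_add, ofReal_exp_add, Finset.mul_sum, Real.exp_sum,
      ENNReal.ofReal_prod_of_nonneg fun _ _ => (Real.exp_pos _).le]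
  rw [h1, attemptLaw, lintegral_prod_mul
    (f := fun q : Fin n → Qubit => ∏ i, ENNReal.ofReal (Real.exp (t * X (q i))))
    (g := fun z : (Finset (Fin n) → Finset (Fin n)) × ℝ => ENNReal.ofReal (Real.exp (t * z.2)))
    (by fun_prop : Measurable _).aemeasurable (by fun_prop),
    lintegral_pi_prod _ (fun _ x => ENNReal.ofReal (Real.exp (t * X x))) (fun _ => by fun_prop), Finset.prod_const, Finset.card_univ, Fintype.card_fin, mul_comm]
  congr 1
  exact measurePreserving_snd.lintegral_comp
    (f := fun x => ENNReal.ofReal (Real.exp (t * x))) (by fun_prop)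

/-- At `t = 0` the integral over successful attempts is the success probability itself. -/
lemma attemptLaw_success_ne_zero {n : ℕ} (hn : 1 ≤ n) :
    attemptLaw P n {a | success P a} ≠ 0 := by
  have h := setLIntegral_success P (n := n) 0
  simp only [zero_mul, Real.exp_zero, ENNReal.ofReal_one, setLIntegral_one] at h
  rw [h]
  exact mul_ne_zero (lmgf_ne_zero measurable_id 0) (lSucc_ne_zero P hn 0)

/-- `E (e^{t D}; failure)`, where `D` is the duration of an attempt. -/
noncomputable def lAttemptFail (n : ℕ) (t : ℝ) : ℝ≥0∞ :=
  ∫⁻ a in {a : Attempt n | success P a}ᶜ, ENNReal.ofReal (Real.exp (t * duration a)) ∂attemptLaw P n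

/-- Stated as a sum because subtraction in `ℝ≥0∞` is truncated; the difference is taken in `ℝ` once
all terms are finite. -/
lemma lAttemptFail_add (n : ℕ) (t : ℝ) :
    lAttemptFail P n t + lmgf id (abLaw P) t * lSucc P n t =
      lmgf id (abLaw P) t * lmgf X (qubitLaw P) t ^ n := by
  rw [← lmgf_duration, ← setLIntegral_success, add_comm, lAttemptFail,
    lintegral_add_compl _ (measurableSet_success P)]
  rfl

lemma lmgf_W {n : ℕ} (hn : 1 ≤ n) (t : ℝ) :
    lmgf (W P) (protocolLaw P n) t =
      (1 - lAttemptFail P n t)⁻¹ * (lmgf id (abLaw P) t * lSucc P n t) := by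
  rw [← setLIntegral_success, lAttemptFail, ← lintegral_firstSuccess (attemptLaw P n)
    (ok := fun a => success P a) (measurableSet_success P) (attemptLaw_success_ne_zero P hn)
    (by fun_prop) (by fun_prop)]
  refine lintegral_congr fun ω => ?_
  rw [W, Finset.sum_range_succ, mul_add, ofReal_exp_add, Finset.mul_sum, Real.exp_sum,
    ENNReal.ofReal_prod_of_nonneg fun _ _ => (Real.exp_pos _).le]

lemma measurable_W (n : ℕ) : Measurable (W P (n := n)) :=
  measurable_sum_range_index
    ((measurable_firstSuccess (ok := fun a => success P a) (measurableSet_success P)).add_const 1)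
    measurable_duration

lemma inv_one_sub_ne_zero (f : ℝ≥0∞) : (1 - f)⁻¹ ≠ 0 := by
  rw [Ne, ENNReal.inv_eq_zero]
  exact ne_top_of_le_ne_top ENNReal.one_ne_top tsub_le_self

lemma inv_one_sub_ne_top_iff {f : ℝ≥0∞} : (1 - f)⁻¹ ≠ ⊤ ↔ f < 1 := by
  rw [Ne, ENNReal.inv_eq_top, tsub_eq_zero_iff_le, not_le]

lemma mul_ne_top_iff {a b : ℝ≥0∞} (ha : a ≠ 0) (hb : b ≠ 0) : a * b ≠ ⊤ ↔ a ≠ ⊤ ∧ b ≠ ⊤ := by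
  rw [Ne, ENNReal.mul_eq_top]
  tauto

lemma toReal_inv_one_sub {f : ℝ≥0∞} (hf : f < 1) : ((1 - f)⁻¹).toReal = (1 - f.toReal)⁻¹ := by
  rw [ENNReal.toReal_inv, ENNReal.toReal_sub_of_le hf.le ENNReal.one_ne_top, ENNReal.toReal_one]

lemma lt_one_iff_toReal {f : ℝ≥0∞} (hf : f ≠ ⊤) : f < 1 ↔ f.toReal < 1 := by
  rw [← ENNReal.toReal_lt_toReal hf ENNReal.one_ne_top, ENNReal.toReal_one]

lemma MK_eq_toReal (t : ℝ) : MK P t = (lmgf id (abLaw P) t).toReal :=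
  mgf_eq_toReal_lmgf measurable_id t

lemma MX_eq_toReal (t : ℝ) : MX P t = (lmgf X (qubitLaw P) t).toReal :=
  mgf_eq_toReal_lmgf measurable_X t

lemma toReal_lAttemptFail {t : ℝ} (hK : lmgf id (abLaw P) t ≠ ⊤)
    (hX : lmgf X (qubitLaw P) t ≠ ⊤) (n : ℕ) :
    lAttemptFail P n t ≠ ⊤ ∧
      (lAttemptFail P n t).toReal = MK P t * (MX P t ^ n - D P n t) := by
  have h := lAttemptFail_add P n t
  have hS := lSucc_ne_top P hX n
  have hF : lAttemptFail P n t ≠ ⊤ := by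
    refine ne_top_of_le_ne_top ?_ (h ▸ le_self_add)
    finiteness
  refine ⟨hF, ?_⟩
  have h' := congrArg ENNReal.toReal h
  rw [ENNReal.toReal_add hF (by finiteness), ENNReal.toReal_mul, ENNReal.toReal_mul,
    ENNReal.toReal_pow, toReal_lSucc P hX, ← MK_eq_toReal, ← MX_eq_toReal] at h'
  linarith

/-- The real inequality has its intended meaning only after `M_K` and `M_X` are known to be finite,
since divergent integrals read as `0` in `ℝ`. So these two are extracted first, from the success
factor. -/
theorem lmgf_W_ne_top_iff {n : ℕ} (hn : 1 ≤ n) (t : ℝ) :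
    lmgf (W P) (protocolLaw P n) t ≠ ⊤ ↔ lmgf id (abLaw P) t ≠ ⊤ ∧
      lmgf X (qubitLaw P) t ≠ ⊤ ∧ MK P t * (MX P t ^ n - D P n t) < 1 := by
  have hK0 : lmgf id (abLaw P) t ≠ 0 := lmgf_ne_zero measurable_id t
  have hS0 := lSucc_ne_zero P hn t
  rw [lmgf_W P hn, mul_ne_top_iff (inv_one_sub_ne_zero _) (mul_ne_zero hK0 hS0),
    mul_ne_top_iff hK0 hS0, inv_one_sub_ne_top_iff]
  constructor
  · rintro ⟨hF, hK, hS⟩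
    have hX := lmgf_X_ne_top_of_lSucc P hn hS
    obtain ⟨h1, h2⟩ := toReal_lAttemptFail P hK hX n
    exact ⟨hK, hX, h2 ▸ (lt_one_iff_toReal h1).1 hF⟩
  · rintro ⟨hK, hX, hF⟩
    obtain ⟨h1, h2⟩ := toReal_lAttemptFail P hK hX n
    exact ⟨(lt_one_iff_toReal h1).2 (h2 ▸ hF), hK, lSucc_ne_top P hX n⟩

theorem mgf_W {n : ℕ} (hn : 1 ≤ n) {t : ℝ} (h : lmgf (W P) (protocolLaw P n) t ≠ ⊤) :
    mgf (W P) (protocolLaw P n) t =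
      MK P t * D P n t / (1 - MK P t * (MX P t ^ n - D P n t)) := by
  obtain ⟨hK, hX, hF⟩ := (lmgf_W_ne_top_iff P hn t).1 h
  obtain ⟨h1, h2⟩ := toReal_lAttemptFail P hK hX n
  rw [mgf_eq_toReal_lmgf (measurable_W P n), lmgf_W P hn, ENNReal.toReal_mul, ENNReal.toReal_mul,
    toReal_inv_one_sub ((lt_one_iff_toReal h1).2 (h2 ▸ hF)), h2, toReal_lSucc P hX, ← MK_eq_toReal,
    div_eq_inv_mul]

/-! ### The teleportation time -/

lemma toReal_lFail (t : ℝ) :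
    (lFail P t).toReal = (1 - P.pSwap) * mgf id (swapComLaw P) t * I P t ⊤ := by
  rw [lFail, ENNReal.toReal_mul, ENNReal.toReal_mul, ENNReal.toReal_ofReal
    (sub_nonneg.2 P.pSwap_le_one), I_eq_toReal_lI, EReal.inv_top, EReal.toReal_zero, lI_zero,
    mgf_eq_toReal_lmgf measurable_id]
  ring

lemma I_top_eq_toReal (t : ℝ) : I P t ⊤ = (lmgf vMax (swapTrialLaw P) t).toReal := by
  rw [I_eq_toReal_lI, EReal.inv_top, EReal.toReal_zero, lI_zero]

theorem lmgf_X_ne_top_iff (t : ℝ) :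
    lmgf X (qubitLaw P) t ≠ ⊤ ↔ lmgf vMax (swapTrialLaw P) t ≠ ⊤ ∧
      lmgf id (swapComLaw P) t ≠ ⊤ ∧ lmgf id (abLaw P) t ≠ ⊤ ∧
      (1 - P.pSwap) * mgf id (swapComLaw P) t * I P t ⊤ < 1 := by
  have hp : ENNReal.ofReal P.pSwap ≠ 0 := (ENNReal.ofReal_pos.2 P.pSwap_pos).ne'
  have hV : lmgf vMax (swapTrialLaw P) t ≠ 0 := lmgf_ne_zero measurable_vMax t
  have hC : lmgf id (swapComLaw P) t ≠ 0 := lmgf_ne_zero measurable_id t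
  have hA : lmgf id (abLaw P) t ≠ 0 := lmgf_ne_zero measurable_id t
  rw [lmgf_X, mul_ne_top_iff (inv_one_sub_ne_zero _)
    (mul_ne_zero hp (mul_ne_zero (mul_ne_zero hV hC) hA)),
    mul_ne_top_iff hp (mul_ne_zero (mul_ne_zero hV hC) hA), mul_ne_top_iff (mul_ne_zero hV hC) hA,
    mul_ne_top_iff hV hC, inv_one_sub_ne_top_iff, ← toReal_lFail]
  -- Finiteness of these factors cannot be read off from `lFail`, whose coefficient vanishes when
  -- `pSwap = 1`; it comes from the success factor.
  have hf (h1 : lmgf vMax (swapTrialLaw P) t ≠ ⊤) (h2 : lmgf id (swapComLaw P) t ≠ ⊤) :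
      lFail P t < 1 ↔ (lFail P t).toReal < 1 := by
    refine lt_one_iff_toReal ?_
    rw [lFail]
    finiteness
  constructor
  · rintro ⟨hF, -, ⟨h1, h2⟩, h3⟩
    exact ⟨h1, h2, h3, (hf h1 h2).1 hF⟩
  · rintro ⟨h1, h2, h3, hF⟩
    exact ⟨(hf h1 h2).2 hF, ENNReal.ofReal_ne_top, ⟨h1, h2⟩, h3⟩

/-- For a null set both sides are `0`, which is the convention for a product with vanishing
probability. -/
lemma integral_cond_mul_real {Ω : Type*} [MeasurableSpace Ω] (μ : Measure Ω) [IsFiniteMeasure μ]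
    (s : Set Ω) (f : Ω → ℝ) :
    (∫ x, f x ∂ProbabilityTheory.cond μ s) * μ.real s = ∫ x in s, f x ∂μ := by
  rw [ProbabilityTheory.cond, integral_smul_measure, ENNReal.toReal_inv, smul_eq_mul]
  by_cases h : μ s = 0
  · rw [measureReal_def, h, ENNReal.toReal_zero, mul_zero, Measure.restrict_eq_zero.2 h,
      integral_zero_measure]
  · rw [measureReal_def, mul_right_comm, inv_mul_cancel₀, one_mul]
    exact ENNReal.toReal_ne_zero.2 ⟨h, measure_ne_top μ s⟩

lemma m1_eq_cond (t : ℝ) :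
    m1 P t = (∫ q, Real.exp (t * X q) ∂(ProbabilityTheory.cond (qubitLaw P) {q | Y P q = 1})) *
      (qubitLaw P).real {q | Y P q = 1} := by
  rw [integral_cond_mul_real, ← integral_indicator
    (measurableSet_eq_fun (measurable_Y P) measurable_const), m1]
  refine integral_congr_ae (ae_of_all _ fun q => ?_)
  rcases Y_eq_zero_or_one P q with h | h <;> simp [Set.indicator, h]

lemma m0_eq_cond (t : ℝ) :
    m0 P t = (∫ q, Real.exp (t * X q) ∂(ProbabilityTheory.cond (qubitLaw P) {q | Y P q = 0})) *
      (qubitLaw P).real {q | Y P q = 0} := by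
  rw [integral_cond_mul_real, ← integral_indicator
    (measurableSet_eq_fun (measurable_Y P) measurable_const), m0]
  refine integral_congr_ae (ae_of_all _ fun q => ?_)
  rcases Y_eq_zero_or_one P q with h | h <;> simp [Set.indicator, h]

lemma m0_eq_sub {t : ℝ} (hX : lmgf X (qubitLaw P) t ≠ ⊤) : m0 P t = MX P t - m1 P t := by
  rw [MX_eq_toReal, ← lm0_add_lm1, ENNReal.toReal_add (lm0_ne_top hX) (lm1_ne_top hX),
    m0_eq_toReal, m1_eq_toReal]
  ring

lemma mgf_tGamma {t : ℝ} (hX : lmgf X (qubitLaw P) t ≠ ⊤) :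
    mgf tGamma (qubitLaw P) t =
      P.pSwap / (1 - (1 - P.pSwap) * mgf id (swapComLaw P) t * I P t ⊤) := by
  obtain ⟨h1, h2, -, h4⟩ := (lmgf_X_ne_top_iff P t).1 hX
  have hF : lFail P t < 1 := by
    rw [lt_one_iff_toReal (by rw [lFail]; finiteness), toReal_lFail]
    exact h4
  rw [mgf_eq_toReal_lmgf measurable_tGamma, lmgf_tGamma, ENNReal.toReal_mul, toReal_inv_one_sub hF,
    toReal_lFail, ENNReal.toReal_ofReal P.pSwap_pos.le, div_eq_inv_mul]

lemma lmgf_X_eq_tGamma (t : ℝ) :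
    lmgf X (qubitLaw P) t = lmgf tGamma (qubitLaw P) t * (lmgf vMax (swapTrialLaw P) t *
      lmgf id (swapComLaw P) t * lmgf id (abLaw P) t) := by
  rw [lmgf_X, lmgf_tGamma]
  ring

lemma MX_eq_mul (t : ℝ) :
    MX P t = mgf tGamma (qubitLaw P) t * I P t ⊤ * mgf id (swapComLaw P) t *
      mgf id (abLaw P) t := by
  rw [MX_eq_toReal, lmgf_X_eq_tGamma, mgf_eq_toReal_lmgf measurable_tGamma,
    mgf_eq_toReal_lmgf measurable_id, mgf_eq_toReal_lmgf measurable_id, I_top_eq_toReal]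
  simp only [ENNReal.toReal_mul]
  ring

lemma m1_eq_mul {t : ℝ} (hX : lmgf X (qubitLaw P) t ≠ ⊤) :
    m1 P t = 1 / 4 * mgf tGamma (qubitLaw P) t *
      (2 * I P t ⊤ * mgf id (swapComLaw P) t * mgf id (abLaw P) t +
        P.w0 ^ 2 * I P t (P.tc : EReal) * mgf id (swapComLaw P) (t - 1 / P.tc) *
          (mgf id (abLaw P) (t - 1 / P.tda) +
            mgf id (abLaw P) (t - 1 / P.tde - 1 / (2 * P.tda)))) := by
  obtain ⟨h1, h2, h3, -⟩ := (lmgf_X_ne_top_iff P t).1 hX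
  have htc := P.tc_pos
  have htde := P.tde_pos
  have htda := P.tda_pos
  have d1 : 0 < 1 / P.tc := by positivity
  have d2 : 0 < 1 / P.tda := by positivity
  have d3 : 0 < 1 / P.tde := by positivity
  have d4 : 0 < 1 / (2 * P.tda) := by positivity
  -- `toReal` respects sums only of finite terms. The decays can only decrease the integrals, since
  -- storage and communication times are almost surely nonnegative.
  have hI : lI P t P.tc⁻¹ ≠ ⊤ := ne_top_of_le_ne_top h1 (lI_anti P (by positivity))
  have hC : lmgf id (swapComLaw P) (t - 1 / P.tc) ≠ ⊤ :=
    ne_top_of_le_ne_top h2 (lmgf_anti (ae_nonneg_seLaw P.shiftSwap_nonneg) (by linarith))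
  have hA1 : lmgf id (abLaw P) (t - 1 / P.tda) ≠ ⊤ :=
    ne_top_of_le_ne_top h3 (lmgf_anti (ae_nonneg_seLaw P.shiftAB_nonneg) (by linarith))
  have hA2 : lmgf id (abLaw P) (t - 1 / P.tde - 1 / (2 * P.tda)) ≠ ⊤ :=
    ne_top_of_le_ne_top h3 (lmgf_anti (ae_nonneg_seLaw P.shiftAB_nonneg) (by linarith))
  have hIc : I P t (P.tc : EReal) = (lI P t P.tc⁻¹).toReal := by
    rw [I_eq_toReal_lI, ← EReal.coe_inv, EReal.toReal_coe]
  rw [m1_eq_toReal, lm1_eq, ← mul_assoc, ← lmgf_tGamma, ENNReal.toReal_mul, ENNReal.toReal_mul,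
    ENNReal.toReal_add (by finiteness) (by finiteness)]
  simp only [ENNReal.toReal_mul, ENNReal.toReal_add hA1 hA2]
  rw [I_top_eq_toReal, hIc, ENNReal.toReal_ofReal (by norm_num),
    ENNReal.toReal_ofReal (by positivity), ENNReal.toReal_ofNat]
  simp only [mgf_eq_toReal_lmgf measurable_tGamma, mgf_eq_toReal_lmgf measurable_id]
  ring

end BB84

theorem theorem1 (P : BB84.Params) (n : ℕ) (hn : 1 ≤ n) (t : ℝ) :
    -- almost surely some attempt succeeds, so the completion time is finite
    (∀ᵐ ω ∂BB84.protocolLaw P n, ∃ r, BB84.success P (ω r)) ∧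
    -- the set of `t` where the MGF of the completion time is finite, and its value there
    (Integrable (fun ω => Real.exp (t * BB84.W P ω)) (BB84.protocolLaw P n) ↔
      Integrable (fun x => Real.exp (t * x)) (BB84.abLaw P) ∧
      Integrable (fun q => Real.exp (t * BB84.X q)) (BB84.qubitLaw P) ∧
      BB84.MK P t * (BB84.MX P t ^ n - BB84.D P n t) < 1) ∧
    (Integrable (fun ω => Real.exp (t * BB84.W P ω)) (BB84.protocolLaw P n) →
      mgf (BB84.W P) (BB84.protocolLaw P n) t =
        BB84.MK P t * BB84.D P n t / (1 - BB84.MK P t * (BB84.MX P t ^ n - BB84.D P n t))) ∧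
    -- the set of `t` where the MGF of the teleportation time is finite
    (Integrable (fun q => Real.exp (t * BB84.X q)) (BB84.qubitLaw P) ↔
      Integrable (fun s => Real.exp (t * BB84.vMax s)) (BB84.swapTrialLaw P) ∧
      Integrable (fun x => Real.exp (t * x)) (BB84.swapComLaw P) ∧
      Integrable (fun x => Real.exp (t * x)) (BB84.abLaw P) ∧
      (1 - P.pSwap) * mgf id (BB84.swapComLaw P) t * BB84.I P t ⊤ < 1) ∧
    -- the expressions for `M_{T_γ}`, `M_X`, `m_1`, `m_0` there
    (Integrable (fun q => Real.exp (t * BB84.X q)) (BB84.qubitLaw P) →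
      mgf BB84.tGamma (BB84.qubitLaw P) t =
        P.pSwap / (1 - (1 - P.pSwap) * mgf id (BB84.swapComLaw P) t * BB84.I P t ⊤) ∧
      BB84.MX P t =
        mgf BB84.tGamma (BB84.qubitLaw P) t * BB84.I P t ⊤ * mgf id (BB84.swapComLaw P) t *
          mgf id (BB84.abLaw P) t ∧
      BB84.m1 P t =
        1 / 4 * mgf BB84.tGamma (BB84.qubitLaw P) t *
          (2 * BB84.I P t ⊤ * mgf id (BB84.swapComLaw P) t * mgf id (BB84.abLaw P) t +
            P.w0 ^ 2 * BB84.I P t (P.tc : EReal) * mgf id (BB84.swapComLaw P) (t - 1 / P.tc) *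
              (mgf id (BB84.abLaw P) (t - 1 / P.tda) +
                mgf id (BB84.abLaw P) (t - 1 / P.tde - 1 / (2 * P.tda)))) ∧
      BB84.m0 P t = BB84.MX P t - BB84.m1 P t ∧
      BB84.m1 P t =
        (∫ q, Real.exp (t * BB84.X q) ∂(ProbabilityTheory.cond (BB84.qubitLaw P)
          {q | BB84.Y P q = 1})) * (BB84.qubitLaw P).real {q | BB84.Y P q = 1} ∧
      BB84.m0 P t =
        (∫ q, Real.exp (t * BB84.X q) ∂(ProbabilityTheory.cond (BB84.qubitLaw P)
          {q | BB84.Y P q = 0})) * (BB84.qubitLaw P).real {q | BB84.Y P q = 0}) := by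
  have hW := BB84.integrable_exp_iff_lmgf (μ := BB84.protocolLaw P n) (BB84.measurable_W P n) t
  have hX := BB84.integrable_exp_iff_lmgf (μ := BB84.qubitLaw P) BB84.measurable_X t
  have hV := BB84.integrable_exp_iff_lmgf (μ := BB84.swapTrialLaw P) BB84.measurable_vMax t
  have hC := BB84.integrable_exp_iff_lmgf (μ := BB84.swapComLaw P) measurable_id t
  have hA := BB84.integrable_exp_iff_lmgf (μ := BB84.abLaw P) measurable_id t
  simp only [id] at hC hA
  rw [hW, hX, hV, hC, hA]
  refine ⟨BB84.ae_exists_success (BB84.attemptLaw P n) (BB84.measurableSet_success P)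
      (BB84.attemptLaw_success_ne_zero P hn), BB84.lmgf_W_ne_top_iff P hn t, BB84.mgf_W P hn,
    BB84.lmgf_X_ne_top_iff P t, fun h => ⟨BB84.mgf_tGamma P h, BB84.MX_eq_mul P t,
      BB84.m1_eq_mul P h, BB84.m0_eq_sub P h, BB84.m1_eq_cond P t, BB84.m0_eq_cond P t⟩⟩
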